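/- **Setting.** A covering game $G$ has agents $[n]=\{1,\dots,n\}$ with costs $c_i\ge 0$ and a collection $\mathcal F\subseteq 2^{[n]}$ of $m$ distinct sets with weights $w_\sigma\ge 0$. In a joint strategy $s\in\{\mathrm{on},\mathrm{off}\}^n$, a set is *uncovered* if none of its elements is on; an agent $i$ pays $c_i$ if it is on, and the total weight of the uncovered sets containing $i$ if it is off. Let $\mathrm{cost}(s)$ be the sum of all agents' payments, $OPT=\min_s\mathrm{cost}(s)$, $F_{\max}=\max_{\sigma\in\mathcal F}|\sigma|$, $c_{\max}=\max_i c_i$, $w_{\min}=\min_\sigma w_\sigma$, and let $\Delta_2$ be the maximum number of sets containing two given distinct agents. In the public service advertising (PSA) model with parameter $\alpha\in(0,1)$ and advertised strategy $s^{ad}$, each agent is receptive independently with probability $\alpha$. Starting from an arbitrary state, in phase 1 the receptive agents play $s^{ad}$ and the others perform best response dynamics (at each step an arbitrary agent that is not playing a best response switches to one) until they reach a joint strategy $s'$ in which every non-receptive agent plays a best response. In phase 2 all agents perform best response dynamics from $s'$ until they reach a Nash equilibrium $s''$. A strategy $s^{ad}$ satisfies $(\star)$ if, with $q=\lfloor c_{\max}/w_{\min}\rfloor$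 and $\Delta_1^*$ the minimum, over the on agents $i$ of $s^{ad}$, of the number of sets that contain $i$ as their unique on element, $$q\,x^{q}\,(1-\alpha^{F_{\max}})^{x-q}\le \frac1{n^2}\qquad\text{for all real } x\ge\frac{\Delta_1^*}{\Delta_2\,(F_{\max}-1)}$$ (no condition if no agent is on). **Statement.** Fix $\alpha\in(0,1)$, an integer $K\ge 0$ and real constants $c_{lo}>0$ and $c_{hi}$. There are an algorithm (a program of a random access machine whose natural and real registers can be added, subtracted and compared at unit cost), a polynomial $p$ and a constant $C$, depending only on $\alpha,K,c_{lo},c_{hi}$, such that for every covering game with $F_{\max}\le K$ and all costs and weights in $[c_{lo},c_{hi}]$, the algorithm, given the game, halts after at most $p(n+m)$ steps and outputs a joint strategy $s^{ad}$ for which, provided that $\Delta_2\ge 1$: 1. $s^{ad}$ satisfies $(\star)$; 2. $\mathrm{cost}(s^{ad})\le C\,\Delta_2\log n\cdot OPT$; 3. in the PSA model with advertised strategy $s^{ad}$, with probability at least $1-1/n$ over the choice of the receptive agents, $\mathrm{cost}(s'')\le C\,\Delta_2\log n\cdot OPT$ for every initial state and every order of the best response moves in the two phases. -/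

import Mathlib

open ProbabilityTheory

/-! ## Covering games -/

/-- A covering game with agents `Fin n` and a collection of `m` distinct sets of agents,
listed as `sets 0, …, sets (m - 1)`; agents have costs and sets have weights. -/
structure CoveringGame (n m : ℕ) where
  sets : Fin m → Finset (Fin n)
  sets_injective : Function.Injective sets
  cost : Fin n → ℝ
  weight : Fin m → ℝ
  cost_nonneg : ∀ i, 0 ≤ cost i
  weight_nonneg : ∀ j, 0 ≤ weight j

/-- A joint strategy of `n` agents; `true` means *on* and `false` means *off*. -/
abbrev Strategy (n : ℕ) := Fin n → Bool

namespace CoveringGame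

variable {n m : ℕ} (G : CoveringGame n m)

/-- No element of the `j`-th set is on. -/
abbrev Uncovered (s : Strategy n) (j : Fin m) : Prop := ∀ k ∈ G.sets j, s k = false

/-- The cost of agent `i`: its own cost if it is on, and otherwise the total weight of the
uncovered sets that contain it. -/
def agentCost (s : Strategy n) (i : Fin n) : ℝ :=
  if s i = true then G.cost i
  else ∑ j with i ∈ G.sets j ∧ G.Uncovered s j, G.weight j

/-- The social cost is the sum of the agents' costs. -/
def socialCost (s : Strategy n) : ℝ := ∑ i, G.agentCost s i

/-- The optimal social cost. -/
noncomputable def opt : ℝ := Finset.univ.inf' Finset.univ_nonempty G.socialCost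

/-- The largest size of a set. -/
def Fmax : ℕ := Finset.univ.sup fun j => (G.sets j).card

/-- The largest number of sets that contain two given distinct agents. -/
def Δ₂ : ℕ :=
  Finset.univ.sup fun p : Fin n × Fin n =>
    (Finset.univ.filter fun j => p.1 ≠ p.2 ∧ p.1 ∈ G.sets j ∧ p.2 ∈ G.sets j).card

/-- The largest cost of an agent. -/
noncomputable def cmax : ℝ := ⨆ i, G.cost i

/-- The smallest weight of a set. -/
noncomputable def wmin : ℝ := ⨅ j, G.weight j

/-- The number of sets that contain agent `i` as the unique on element in `s`. -/
def soleCount (s : Strategy n) (i : Fin n) : ℕ :=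
  (Finset.univ.filter fun j =>
    i ∈ G.sets j ∧ s i = true ∧ ∀ k ∈ G.sets j, s k = true → k = i).card

/-- The core minimum degree `Δ₁*(s)`: the smallest number of sets that an on element of `s`
covers as the unique on element (`⊤` if nobody is on). -/
noncomputable def coreMinDegree (s : Strategy n) : ℕ∞ :=
  ⨅ (i : Fin n) (_ : s i = true), (G.soleCount s i : ℕ∞)

/-- The condition `(⋆)`. There is nothing to check if `Δ₁*(s) = ⊤`. -/
def Star (α : ℝ) (s : Strategy n) : Prop :=
  ∀ (x : ℝ) (d : ℕ), G.coreMinDegree s = d →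
    (d : ℝ) / ((G.Δ₂ : ℝ) * ((G.Fmax : ℝ) - 1)) ≤ x →
      (⌊G.cmax / G.wmin⌋₊ : ℝ) * x ^ ⌊G.cmax / G.wmin⌋₊ *
          (1 - α ^ G.Fmax) ^ (x - (⌊G.cmax / G.wmin⌋₊ : ℝ))
        ≤ 1 / (n : ℝ) ^ 2

/-! ## Best response dynamics and public service advertising -/

/-- In `s`, agent `i` plays a best response to the other agents. -/
def IsBestResponse (s : Strategy n) (i : Fin n) : Prop :=
  ∀ a : Bool, G.agentCost s i ≤ G.agentCost (Function.update s i a) i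

/-- One step of best response dynamics among the agents in `free`: some agent in `free` that is
not playing a best response switches to a best response. -/
def BRStep (free : Set (Fin n)) (s t : Strategy n) : Prop :=
  ∃ i ∈ free, ¬ G.IsBestResponse s i ∧
    (∃ a : Bool, t = Function.update s i a) ∧ G.IsBestResponse t i

/-- `s` is a Nash equilibrium among the agents in `free`, given the actions of the others. -/
def NashOn (free : Set (Fin n)) (s : Strategy n) : Prop :=
  ∀ i ∈ free, G.IsBestResponse s i

/-- The strategy `s` after the agents in `A` switched to the advertised strategy. -/
noncomputable def adopt (A : Set (Fin n)) (sad s : Strategy n) : Strategy n :=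
  open Classical in fun i => if i ∈ A then sad i else s i

/-- A possible course of the public service advertising model with initial state `s₀`, advertised
strategy `sad` and set `A` of receptive agents. In the first phase the agents in `A` play `sad`
while the others follow best response dynamics up to a joint strategy `s'` in equilibrium given
the behaviour of `A`; in the second phase all agents follow best response dynamics from `s'` up to
a Nash equilibrium `s''`. -/
structure PSAOutcome (sad : Strategy n) (A : Set (Fin n)) (s₀ s' s'' : Strategy n) : Prop where
  phase1 : Relation.ReflTransGen (G.BRStep Aᶜ) (adopt A sad s₀) s'
  nash1 : G.NashOn Aᶜ s'
  phase2 : Relation.ReflTransGen (G.BRStep Set.univ) s' s''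
  nash2 : G.NashOn Set.univ s''

/-- The probability that the random set of receptive agents, which contains each agent
independently with probability `α`, is such that, whatever the initial state and whatever the
order of the best response moves, the final state `s''` has social cost at most `b`. -/
noncomputable def probFinalCostLE (α : unitInterval) (sad : Strategy n) (b : ℝ) : ℝ :=
  (setBernoulli (Set.univ : Set (Fin n)) α).real
    {A | ∀ s₀ s' s'', G.PSAOutcome sad A s₀ s' s'' → G.socialCost s'' ≤ b}

/-! Best response dynamics always terminate, so that every run has a final state `s''`. -/

/-- The potential function. -/
def potential (s : Strategy n) : ℝ :=
  (∑ i, if s i = true then G.cost i else 0) + ∑ j, if G.Uncovered s j then G.weight j else 0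

theorem potential_on_sub_off (s : Strategy n) (i : Fin n) :
    G.potential (Function.update s i true) - G.potential (Function.update s i false) =
      G.agentCost (Function.update s i true) i - G.agentCost (Function.update s i false) i := by
  have h1 : (∑ k, if Function.update s i true k = true then G.cost k else 0) -
      (∑ k, if Function.update s i false k = true then G.cost k else 0) = G.cost i := by
    rw [← Finset.sum_sub_distrib, Finset.sum_eq_single i]
    · simp
    · intro k _ hk
      simp [Function.update_of_ne hk]
    · simp
  have h2 : (∑ j, if G.Uncovered (Function.update s i true) j then G.weight j else 0) -
      (∑ j, if G.Uncovered (Function.update s i false) j then G.weight j else 0) =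
      - ∑ j with i ∈ G.sets j ∧ G.Uncovered (Function.update s i false) j, G.weight j := by
    rw [← Finset.sum_sub_distrib, Finset.sum_filter, ← Finset.sum_neg_distrib]
    refine Finset.sum_congr rfl fun j _ => ?_
    by_cases hij : i ∈ G.sets j
    · have : ¬ G.Uncovered (Function.update s i true) j := fun h => by simpa using h i hij
      by_cases hu : G.Uncovered (Function.update s i false) j <;> simp [this, hij, hu]
    · have : G.Uncovered (Function.update s i true) j ↔
          G.Uncovered (Function.update s i false) j := by
        refine forall₂_congr fun k hk => ?_
        have hki : k ≠ i := fun h => hij (h ▸ hk)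
        simp [Function.update_of_ne hki]
      by_cases hu : G.Uncovered (Function.update s i false) j <;> simp [this, hij, hu]
  have h3 : G.agentCost (Function.update s i true) i = G.cost i := by simp [agentCost]
  have h4 : G.agentCost (Function.update s i false) i =
      ∑ j with i ∈ G.sets j ∧ G.Uncovered (Function.update s i false) j, G.weight j := by
    simp [agentCost]
  rw [h3, h4]
  unfold potential
  linarith

theorem potential_lt_of_brStep {free : Set (Fin n)} {s t : Strategy n} (h : G.BRStep free s t) :
    G.potential t < G.potential s := by
  obtain ⟨i, -, hs, ⟨a, rfl⟩, ht⟩ := h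
  have hlt : G.agentCost (Function.update s i a) i < G.agentCost s i := by
    by_contra hle
    refine hs fun b => (not_lt.mp hle).trans ?_
    simpa using ht b
  have key := G.potential_on_sub_off s i
  have hs' : s = Function.update s i (s i) := (Function.update_eq_self i s).symm
  cases a <;> cases hsi : s i <;> rw [hsi] at hs' <;> rw [hs'] at hlt ⊢ <;>
    simp only [Function.update_idem] at hlt ⊢ <;> linarith

theorem brStep_wellFounded (free : Set (Fin n)) :
    WellFounded fun t s => G.BRStep free s t :=
  haveI : IsTrans (Strategy n) (InvImage (· < ·) G.potential) := ⟨fun _ _ _ => lt_trans⟩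
  haveI : Std.Irrefl (InvImage (· < ·) G.potential) := ⟨fun _ => lt_irrefl _⟩
  Subrelation.wf (fun h => G.potential_lt_of_brStep h)
    (Finite.wellFounded_of_trans_of_irrefl (InvImage (· < ·) G.potential))

theorem exists_nashOn (free : Set (Fin n)) (s : Strategy n) :
    ∃ t, Relation.ReflTransGen (G.BRStep free) s t ∧ G.NashOn free t := by
  classical
  induction s using (G.brStep_wellFounded free).induction with
  | _ s ih =>
    by_cases hN : G.NashOn free s
    · exact ⟨s, .refl, hN⟩
    · simp only [NashOn, not_forall] at hN
      obtain ⟨i, hi, hs⟩ := hN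
      obtain ⟨a, ha⟩ := Finite.exists_min fun a : Bool => G.agentCost (Function.update s i a) i
      have hstep : G.BRStep free s (Function.update s i a) :=
        ⟨i, hi, hs, ⟨a, rfl⟩, fun b => by simpa using ha b⟩
      obtain ⟨t, ht, hN⟩ := ih _ hstep
      exact ⟨t, .head hstep ht, hN⟩

theorem exists_psaOutcome (sad : Strategy n) (A : Set (Fin n)) (s₀ : Strategy n) :
    ∃ s' s'', G.PSAOutcome sad A s₀ s' s'' := by
  obtain ⟨s', h1, h2⟩ := G.exists_nashOn Aᶜ (adopt A sad s₀)
  obtain ⟨s'', h3, h4⟩ := G.exists_nashOn Set.univ s'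
  exact ⟨s', s'', h1, h2, h3, h4⟩

end CoveringGame

/-! ## Algorithms

A random access machine with registers and arrays for natural numbers and, separately, for real
numbers. Its arithmetic consists of addition, subtraction and comparison, which take one step
each. There is no multiplication and no rounding, so that the bit length of the numbers that are
stored grows by at most a constant per step (for rational data, a polynomial number of steps can
be simulated on a Turing machine in polynomial time). A program is a fixed finite object. -/

namespace RAM

/-- The memory: registers `reg x`, arrays `arr a` with cells `arr a k`, and the same for reals. -/
structure Store where
  reg : ℕ → ℕ
  arr : ℕ → ℕ → ℕ
  rreg : ℕ → ℝ
  rarr : ℕ → ℕ → ℝ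

/-- Expressions for natural numbers; `sub` is truncated subtraction. -/
inductive NExpr where
  | const (k : ℕ)
  | reg (x : ℕ)
  | arr (a : ℕ) (idx : NExpr)
  | add (e f : NExpr)
  | sub (e f : NExpr)

/-- Expressions for real numbers; the constants of a program are rational. -/
inductive RExpr where
  | const (q : ℚ)
  | reg (x : ℕ)
  | arr (a : ℕ) (idx : NExpr)
  | add (e f : RExpr)
  | sub (e f : RExpr)

/-- Comparisons. -/
inductive Test where
  | lt (e f : NExpr)
  | rlt (e f : RExpr)

/-- Programs. -/
inductive Cmd where
  | skip
  | setReg (x : ℕ) (e : NExpr)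
  | setArr (a : ℕ) (idx e : NExpr)
  | setRReg (x : ℕ) (e : RExpr)
  | setRArr (a : ℕ) (idx : NExpr) (e : RExpr)
  | seq (c d : Cmd)
  | branch (b : Test) (c d : Cmd)
  | loop (b : Test) (c : Cmd)

def NExpr.eval (σ : Store) : NExpr → ℕ
  | .const k => k
  | .reg x => σ.reg x
  | .arr a idx => σ.arr a (idx.eval σ)
  | .add e f => e.eval σ + f.eval σ
  | .sub e f => e.eval σ - f.eval σ

noncomputable def RExpr.eval (σ : Store) : RExpr → ℝ
  | .const q => q
  | .reg x => σ.rreg x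
  | .arr a idx => σ.rarr a (idx.eval σ)
  | .add e f => e.eval σ + f.eval σ
  | .sub e f => e.eval σ - f.eval σ

def Test.Holds (σ : Store) : Test → Prop
  | .lt e f => e.eval σ < f.eval σ
  | .rlt e f => e.eval σ < f.eval σ

/-- The number of steps that it takes to evaluate an expression. -/
def NExpr.time : NExpr → ℕ
  | .const _ => 1
  | .reg _ => 1
  | .arr _ idx => idx.time + 1
  | .add e f => e.time + f.time + 1
  | .sub e f => e.time + f.time + 1

/-- The number of steps that it takes to evaluate an expression. -/
def RExpr.time : RExpr → ℕ
  | .const _ => 1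
  | .reg _ => 1
  | .arr _ idx => idx.time + 1
  | .add e f => e.time + f.time + 1
  | .sub e f => e.time + f.time + 1

/-- The number of steps that it takes to make a comparison. -/
def Test.time : Test → ℕ
  | .lt e f => e.time + f.time + 1
  | .rlt e f => e.time + f.time + 1

/-- `Runs c σ t σ'`: started on the memory `σ`, the program `c` halts after exactly `t` steps, with
the memory `σ'`. -/
inductive Runs : Cmd → Store → ℕ → Store → Prop
  | skip (σ : Store) : Runs .skip σ 1 σ
  | setReg (x : ℕ) (e : NExpr) (σ : Store) :
      Runs (.setReg x e) σ (e.time + 1)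
        { σ with reg := Function.update σ.reg x (e.eval σ) }
  | setArr (a : ℕ) (idx e : NExpr) (σ : Store) :
      Runs (.setArr a idx e) σ (idx.time + e.time + 1)
        { σ with
          arr := Function.update σ.arr a
            (Function.update (σ.arr a) (idx.eval σ) (e.eval σ)) }
  | setRReg (x : ℕ) (e : RExpr) (σ : Store) :
      Runs (.setRReg x e) σ (e.time + 1)
        { σ with rreg := Function.update σ.rreg x (e.eval σ) }
  | setRArr (a : ℕ) (idx : NExpr) (e : RExpr) (σ : Store) :
      Runs (.setRArr a idx e) σ (idx.time + e.time + 1)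
        { σ with
          rarr := Function.update σ.rarr a
            (Function.update (σ.rarr a) (idx.eval σ) (e.eval σ)) }
  | seq {c d : Cmd} {σ σ₁ σ₂ : Store} {t₁ t₂ : ℕ} :
      Runs c σ t₁ σ₁ → Runs d σ₁ t₂ σ₂ → Runs (.seq c d) σ (t₁ + t₂) σ₂
  | branch_true {b : Test} {c d : Cmd} {σ σ₁ : Store} {t : ℕ} :
      b.Holds σ → Runs c σ t σ₁ → Runs (.branch b c d) σ (b.time + t) σ₁
  | branch_false {b : Test} {c d : Cmd} {σ σ₁ : Store} {t : ℕ} :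
      ¬ b.Holds σ → Runs d σ t σ₁ → Runs (.branch b c d) σ (b.time + t) σ₁
  | loop_true {b : Test} {c : Cmd} {σ σ₁ σ₂ : Store} {t₁ t₂ : ℕ} :
      b.Holds σ → Runs c σ t₁ σ₁ → Runs (.loop b c) σ₁ t₂ σ₂ →
        Runs (.loop b c) σ (b.time + t₁ + t₂) σ₂
  | loop_false {b : Test} {c : Cmd} {σ : Store} :
      ¬ b.Holds σ → Runs (.loop b c) σ b.time σ

end RAM

open Classical in
/-- The memory that holds a covering game as input: `n` and `m` in registers `0` and `1`, the
incidence matrix of the sets, row after row, in array `0`, the costs in real array `0` and the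
weights in real array `1`; everything else is `0`. -/
noncomputable def CoveringGame.inputStore {n m : ℕ} (G : CoveringGame n m) : RAM.Store where
  reg x := if x = 0 then n else if x = 1 then m else 0
  arr a k :=
    if a = 0 ∧ ∃ (j : Fin m) (i : Fin n), k = (j : ℕ) * n + (i : ℕ) ∧ i ∈ G.sets j then 1 else 0
  rreg _ := 0
  rarr a k :=
    if a = 0 then if h : k < n then G.cost ⟨k, h⟩ else 0
    else if a = 1 then if h : k < m then G.weight ⟨k, h⟩ else 0
    else 0

/-- The strategy read off from the memory at the end of a computation: agent `i` is on if cell `i`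
of array `1` is not `0`. -/
def RAM.Store.strategy (σ : RAM.Store) (n : ℕ) : Strategy n := fun i => σ.arr 1 i != 0

/-!
The algorithm turns on all elements of a maximal family `T` of pairwise disjoint nonempty sets,
which yields a cover `s₀`, and then goes once through the agents, turning off each one that is at
that moment the unique on element of fewer than `D = c₀ * Δ₂ * (⌈log₂ n⌉ + 1)` sets. Turning an
agent off can only increase the number of sets that another agent covers alone, so at the end every
on agent is the unique on element of at least `D` sets, which gives `(⋆)` if the constant `c₀` is
large enough (`exists_threshold`, `star_of_le_soleCount`). Disjoint sets have to be paid for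
separately, so that `OPT` is at least `lo * |T|`, whereas there are at most `K * |T|` on agents,
and at most `D` sets are uncovered for each agent that was turned off (`IsPruned`,
`IsPruned.cost_bounds`). Hence the advertised strategy costs `O(Δ₂ * log n) * OPT`.

For the final state, fix an advertised on agent `k`. As any two agents share at most `Δ₂` sets of
size at most `K`, among the sets that `k` covers alone there are `(Q + 1) * r`, with
`Q = ⌊hi / lo⌋` and `r` of order `log n`, that are pairwise disjoint outside of `k`. They are split
into `Q + 1` groups of size `r`. The other elements of a given set are all receptive with
probability at least `α ^ (K + 1)`, independently for disjoint sets, so that with probability at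
least `1 - 1 / n ^ 2` each group has a set all of whose other elements are receptive, and hence off
in the first phase (`setBernoulli_not_supportsAgent_le`). If `k` were off at the end of that phase,
these `Q + 1` sets would be uncovered, and their weight exceeds the cost of `k`. So with
probability at least `1 - 1 / n` all advertised on agents are on
(`PSAOutcome.eq_true_of_supportsAgent`). Then only sets that are uncovered by the advertised
strategy can be uncovered, and each further on agent, playing a best response, is the unique on
element of such a set (`card_onAgents_le`). Therefore the potential at the end of the first phase
is `O(Δ₂ * log n) * OPT`. It decreases in the second phase, and the social cost is at most `K + 1`
times the potential, empty sets left aside (`socialCost_le_of_reflTransGen`).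

The program is analysed with a Hoare logic that bounds running times (`HaltsWithin`); all its loops
are `for` loops.
-/

/-! ### Independence of the elements of a Bernoulli random set -/

theorem iIndepFun_mem_setBernoulli {ι : Type*} (u : Set ι) (α : unitInterval) :
    iIndepFun (fun (i : ι) (A : Set ι) => i ∈ A) (setBernoulli u α) := by
  rw [iIndepFun_iff_map_fun_eq_infinitePi_map (by fun_prop), setBernoulli_eq_map,
    MeasureTheory.Measure.map_map (by fun_prop) (by fun_prop)]
  have h : ∀ (μ : MeasureTheory.Measure (ι → Prop)) (i : ι),
      (μ.map fun p : ι → Prop => {i | p i}).map (fun A : Set ι => i ∈ A) =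
        μ.map fun p : ι → Prop => p i := fun μ i =>
    MeasureTheory.Measure.map_map (by fun_prop) (by fun_prop)
  simp_rw [h, MeasureTheory.Measure.infinitePi_map_eval]
  exact MeasureTheory.Measure.map_id

theorem setBernoulli_real_superset {ι : Type*} [Finite ι] (α : unitInterval) (P : Finset ι) :
    (setBernoulli (Set.univ : Set ι) α).real {A | (P : Set ι) ⊆ A} = (α : ℝ) ^ P.card := by
  have h : (fun p : ι → Prop => {i | p i}) ⁻¹' {A | (P : Set ι) ⊆ A} =
      (P : Set ι).pi fun _ => {True} := by
    ext p
    simp [Set.subset_def, Set.mem_pi]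
  rw [MeasureTheory.measureReal_def, setBernoulli_apply', h,
    MeasureTheory.Measure.infinitePi_pi _ (by simp)]
  simp

/-- The events that the random set contains given pairwise disjoint finite sets are independent,
so that the probability that none of them occurs is a product. -/
theorem setBernoulli_real_forall_not_superset {ι κ : Type*} [Finite ι] (α : unitInterval)
    (B : Finset κ) (f : κ → Finset ι) (hf : (B : Set κ).PairwiseDisjoint f) :
    (setBernoulli (Set.univ : Set ι) α).real {A | ∀ b ∈ B, ¬ (f b : Set ι) ⊆ A} =
      ∏ b ∈ B, (1 - (α : ℝ) ^ (f b).card) := by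
  classical
  induction B using Finset.induction_on with
  | empty => simp
  | insert b B hb ih =>
    rw [Finset.coe_insert, Set.pairwiseDisjoint_insert_of_notMem (by simpa using hb)] at hf
    rw [Finset.prod_insert hb, ← ih hf.1, ← setBernoulli_real_superset α (f b),
      ← MeasureTheory.probReal_compl_eq_one_sub .of_discrete]
    have hST : Disjoint (f b) (B.biUnion f) := by
      rw [Finset.disjoint_biUnion_right]
      exact fun c hc => hf.2 c (by simpa using hc)
    have hind := (iIndepFun_mem_setBernoulli (Set.univ : Set ι) α).indepFun_finset _ _ hST
      (by intro i; fun_prop)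
    have key := hind.measure_inter_preimage_eq_mul {p | ¬ ∀ i, p i}
      {p | ∀ c (hc : c ∈ B), ¬ ∀ i (hi : i ∈ f c), p ⟨i, Finset.mem_biUnion.mpr ⟨c, hc, hi⟩⟩}
      .of_discrete .of_discrete
    have hb' : (fun (A : Set ι) (i : f b) => (i : ι) ∈ A) ⁻¹' {p | ¬ ∀ i, p i} =
        {A | (f b : Set ι) ⊆ A}ᶜ := by
      ext A
      simp [Set.subset_def]
    have hB' : (fun (A : Set ι) (i : B.biUnion f) => (i : ι) ∈ A) ⁻¹'
        {p | ∀ c (hc : c ∈ B), ¬ ∀ i (hi : i ∈ f c), p ⟨i, Finset.mem_biUnion.mpr ⟨c, hc, hi⟩⟩} =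
        {A | ∀ c ∈ B, ¬ (f c : Set ι) ⊆ A} := by
      ext A
      simp [Set.subset_def]
    have hbB : {A : Set ι | ∀ c ∈ insert b B, ¬ (f c : Set ι) ⊆ A} =
        {A | (f b : Set ι) ⊆ A}ᶜ ∩ {A | ∀ c ∈ B, ¬ (f c : Set ι) ⊆ A} := by
      ext A
      simp
    rw [hb', hB', ← hbB] at key
    simp only [MeasureTheory.measureReal_def]
    rw [key, ENNReal.toReal_mul]

/-! ### Numerical thresholds -/

/-- The expressions in the condition `(⋆)` and in the union bound decay exponentially in `x`, so
that they are at most `1 / n ^ 2` once `x` exceeds a constant multiple of `ℓ + 1`, where `ℓ = log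
n`. -/
theorem exists_threshold {β : ℝ} (hβ0 : 0 < β) (hβ1 : β < 1) (Q : ℕ) :
    ∃ a : ℕ, 1 ≤ a ∧ ∀ ℓ x : ℝ, 0 ≤ ℓ → a * (ℓ + 1) ≤ x →
      1 ≤ x ∧ Q ≤ x ∧ Q * x ^ Q * β ^ (x - Q) ≤ Real.exp (-(2 * ℓ)) ∧
        (Q + 1) * β ^ x ≤ Real.exp (-(2 * ℓ)) := by
  obtain ⟨c, hc⟩ : ∃ c, c = -Real.log β := ⟨_, rfl⟩
  have hc0 : 0 < c := by rw [hc]; exact neg_pos.mpr (Real.log_neg hβ0 hβ1)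
  have hpow : ∀ y : ℝ, β ^ y = Real.exp (-(c * y)) := fun y => by
    rw [Real.rpow_def_of_pos hβ0, hc]; ring_nf
  set M : ℝ := Q * (Q.factorial * (2 / c) ^ Q) * Real.exp (c * Q) + (Q + 1) with hM
  have hM0 : 0 ≤ Q * (Q.factorial * (2 / c) ^ Q) * Real.exp (c * Q) := by positivity
  obtain ⟨a, ha⟩ := exists_nat_ge (max (max 1 (Q : ℝ)) (2 * (2 + M) / c))
  have ha1 : (1 : ℝ) ≤ a := (le_max_left _ _).trans ((le_max_left _ _).trans ha)
  have haQ : (Q : ℝ) ≤ a := (le_max_right _ _).trans ((le_max_left _ _).trans ha)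
  have haM : 2 + M ≤ c * a / 2 := by
    have := (le_max_right _ _).trans ha
    rw [div_le_iff₀ hc0] at this
    linarith
  refine ⟨a, by exact_mod_cast ha1, fun ℓ x hℓ hx => ?_⟩
  have hax : (a : ℝ) ≤ x := by nlinarith
  have hx0 : 0 < x := by linarith
  have hcx : 2 * ℓ + M ≤ c * x / 2 := by
    have h1 : (2 + M) * (ℓ + 1) ≤ c * a / 2 * (ℓ + 1) :=
      mul_le_mul_of_nonneg_right haM (by linarith)
    have h2 : c * (a * (ℓ + 1)) ≤ c * x := mul_le_mul_of_nonneg_left hx hc0.le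
    have h3 : 0 ≤ M * ℓ := mul_nonneg (by rw [hM]; positivity) hℓ
    linarith
  have hMexp : M * Real.exp (-(c * x / 2)) ≤ Real.exp (-(2 * ℓ)) := by
    have h1 : M ≤ Real.exp M := by linarith [Real.add_one_le_exp M]
    calc M * Real.exp (-(c * x / 2)) ≤ Real.exp M * Real.exp (-(c * x / 2)) := by gcongr
      _ = Real.exp (M - c * x / 2) := by rw [← Real.exp_add]; ring_nf
      _ ≤ _ := Real.exp_le_exp.mpr (by linarith)
  refine ⟨by linarith, by linarith, le_trans ?_ hMexp, le_trans ?_ hMexp⟩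
  -- half of the exponential decay absorbs the power of `x`
  · have hxQ : x ^ Q ≤ Q.factorial * (2 / c) ^ Q * Real.exp (c * x / 2) := by
      have := Real.pow_div_factorial_le_exp (c * x / 2) (by positivity) Q
      rw [div_le_iff₀ (by positivity)] at this
      calc x ^ Q = (2 / c) ^ Q * (c * x / 2) ^ Q := by
            rw [← mul_pow]; congr 1; field_simp
        _ ≤ (2 / c) ^ Q * (Real.exp (c * x / 2) * Q.factorial) := by gcongr
        _ = _ := by ring
    calc Q * x ^ Q * β ^ (x - Q)
        ≤ Q * (Q.factorial * (2 / c) ^ Q * Real.exp (c * x / 2)) * Real.exp (-(c * (x - Q))) := by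
          rw [hpow]; gcongr
      _ = Q * (Q.factorial * (2 / c) ^ Q) * Real.exp (c * Q) * Real.exp (-(c * x / 2)) := by
          have : Real.exp (c * x / 2) * Real.exp (-(c * (x - Q))) =
              Real.exp (c * Q) * Real.exp (-(c * x / 2)) := by
            rw [← Real.exp_add, ← Real.exp_add]; ring_nf
          linear_combination (Q * (Q.factorial * (2 / c) ^ Q)) * this
      _ ≤ _ := by gcongr; linarith [(Q.cast_nonneg : (0 : ℝ) ≤ Q)]
  · rw [hpow]
    gcongr
    · linarith
    · nlinarith

/-! ### Social cost, potential and uncovered sets -/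

namespace CoveringGame

variable {n m : ℕ} (G : CoveringGame n m)

/-- The agents that are on. -/
def onAgents (s : Strategy n) : Finset (Fin n) := {i | s i = true}

/-- The nonempty uncovered sets. An empty set is uncovered in every joint strategy, but it does not
contribute to the social cost. -/
def uncoveredSets (s : Strategy n) : Finset (Fin m) := {j | (G.sets j).Nonempty ∧ G.Uncovered s j}

@[simp] theorem mem_onAgents {s : Strategy n} {i : Fin n} : i ∈ onAgents s ↔ s i = true := by
  simp [onAgents]

@[simp] theorem mem_uncoveredSets {s : Strategy n} {j : Fin m} :
    j ∈ G.uncoveredSets s ↔ (G.sets j).Nonempty ∧ G.Uncovered s j := by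
  simp [uncoveredSets]

theorem agentCost_nonneg (s : Strategy n) (i : Fin n) : 0 ≤ G.agentCost s i := by
  unfold agentCost
  split_ifs
  · exact G.cost_nonneg i
  · exact Finset.sum_nonneg fun j _ => G.weight_nonneg j

theorem card_sets_le_Fmax (j : Fin m) : (G.sets j).card ≤ G.Fmax :=
  Finset.le_sup (f := fun j => (G.sets j).card) (Finset.mem_univ j)

theorem card_filter_le_Δ₂ {i k : Fin n} (h : i ≠ k) :
    (Finset.univ.filter fun j => i ∈ G.sets j ∧ k ∈ G.sets j).card ≤ G.Δ₂ := by
  refine le_trans (le_of_eq ?_) (Finset.le_sup (f := fun p : Fin n × Fin n =>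
    (Finset.univ.filter fun j => p.1 ≠ p.2 ∧ p.1 ∈ G.sets j ∧ p.2 ∈ G.sets j).card)
    (Finset.mem_univ (i, k)))
  simp [h]

theorem socialCost_eq (s : Strategy n) :
    G.socialCost s = (∑ i ∈ onAgents s, G.cost i) +
      ∑ j ∈ G.uncoveredSets s, (G.sets j).card * G.weight j := by
  have h : ∀ i, G.agentCost s i = (if s i = true then G.cost i else 0) +
      ∑ j, if i ∈ G.sets j ∧ G.Uncovered s j then G.weight j else 0 := by
    intro i
    rw [← Finset.sum_filter]
    unfold agentCost
    by_cases hi : s i = true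
    · rw [if_pos hi, if_pos hi, Finset.filter_eq_empty_iff.mpr]
      · simp
      · rintro j - ⟨hij, hu⟩
        simp [hu i hij] at hi
    · rw [if_neg hi, if_neg hi, zero_add]
  simp only [socialCost, h, Finset.sum_add_distrib, onAgents, uncoveredSets, Finset.sum_filter]
  congr 1
  rw [Finset.sum_comm]
  refine Finset.sum_congr rfl fun j _ => ?_
  by_cases hu : G.Uncovered s j
  · by_cases hj : (G.sets j).Nonempty
    · simp [eq_true hu, hj]
    · simp [Finset.not_nonempty_iff_eq_empty.mp hj]
  · simp [hu]

theorem socialCost_le {K : ℕ} {hi : ℝ} (hK : G.Fmax ≤ K) (hc : ∀ i, G.cost i ≤ hi)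
    (hw : ∀ j, G.weight j ≤ hi) (s : Strategy n) :
    G.socialCost s ≤ (onAgents s).card * hi + (G.uncoveredSets s).card * (K * hi) := by
  rw [socialCost_eq, ← nsmul_eq_mul, ← nsmul_eq_mul]
  refine add_le_add (Finset.sum_le_card_nsmul _ _ _ fun i _ => hc i)
    (Finset.sum_le_card_nsmul _ _ _ fun j _ => ?_)
  have := (G.card_sets_le_Fmax j).trans hK
  exact mul_le_mul (by exact_mod_cast this) (hw j) (G.weight_nonneg j) (by positivity)

/-- Disjoint nonempty sets have to be paid for separately. -/
theorem card_mul_le_opt {lo : ℝ} (hc : ∀ i, lo ≤ G.cost i) (hw : ∀ j, lo ≤ G.weight j)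
    (T : Finset (Fin m)) (hT : (T : Set (Fin m)).PairwiseDisjoint G.sets)
    (hne : ∀ j ∈ T, (G.sets j).Nonempty) : T.card * lo ≤ G.opt := by
  refine Finset.le_inf' _ _ fun s _ => ?_
  calc T.card * lo = ∑ _j ∈ T, lo := by simp
    _ ≤ ∑ j ∈ T, ∑ i ∈ G.sets j, G.agentCost s i := by
      refine Finset.sum_le_sum fun j hj => ?_
      have hex : ∃ i ∈ G.sets j, lo ≤ G.agentCost s i := by
        by_cases hu : G.Uncovered s j
        · obtain ⟨i, hi⟩ := hne j hj
          refine ⟨i, hi, ?_⟩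
          rw [agentCost, if_neg (by simp [hu i hi])]
          exact (hw j).trans (Finset.single_le_sum (f := G.weight)
            (fun k _ => G.weight_nonneg k) (by simp [hi, eq_true hu]))
        · simp only [Uncovered, not_forall, Bool.not_eq_false] at hu
          obtain ⟨i, hi, hs⟩ := hu
          exact ⟨i, hi, by rw [agentCost, if_pos hs]; exact hc i⟩
      obtain ⟨i, hi, hle⟩ := hex
      exact hle.trans (Finset.single_le_sum (f := G.agentCost s)
        (fun k _ => G.agentCost_nonneg s k) hi)
    _ = ∑ i ∈ T.biUnion G.sets, G.agentCost s i := (Finset.sum_biUnion hT).symm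
    _ ≤ G.socialCost s := Finset.sum_le_sum_of_subset_of_nonneg (Finset.subset_univ _)
      fun i _ _ => G.agentCost_nonneg s i

theorem potential_eq (s : Strategy n) :
    G.potential s = (∑ i ∈ onAgents s, G.cost i) + (∑ j ∈ G.uncoveredSets s, G.weight j) +
      ∑ j with ¬ (G.sets j).Nonempty, G.weight j := by
  simp only [potential, onAgents, uncoveredSets, Finset.sum_filter, add_assoc]
  congr 1
  rw [← Finset.sum_add_distrib]
  refine Finset.sum_congr rfl fun j _ => ?_
  by_cases hj : (G.sets j).Nonempty
  · simp [hj]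
  · simp [Finset.not_nonempty_iff_eq_empty.mp hj, Uncovered]

theorem potential_le_of_reflTransGen {free : Set (Fin n)} {s t : Strategy n}
    (h : Relation.ReflTransGen (G.BRStep free) s t) : G.potential t ≤ G.potential s := by
  induction h with
  | refl => exact le_rfl
  | tail _ hst ih => exact (G.potential_lt_of_brStep hst).le.trans ih

/-- The social cost exceeds the potential at most by the factor `Fmax`, and the potential decreases
along best response dynamics. -/
theorem socialCost_le_of_reflTransGen {K : ℕ} {hi : ℝ} (hK : G.Fmax ≤ K)
    (hc : ∀ i, G.cost i ≤ hi) (hw : ∀ j, G.weight j ≤ hi) {free : Set (Fin n)} {s t : Strategy n}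
    (h : Relation.ReflTransGen (G.BRStep free) s t) :
    G.socialCost t ≤ (K + 1) * (((onAgents s).card + (G.uncoveredSets s).card) * hi) := by
  have hp := G.potential_le_of_reflTransGen h
  rw [potential_eq, potential_eq] at hp
  have h1 := Finset.sum_le_card_nsmul (onAgents s) G.cost hi fun i _ => hc i
  have h2 := Finset.sum_le_card_nsmul (G.uncoveredSets s) G.weight hi fun j _ => hw j
  rw [nsmul_eq_mul] at h1 h2
  have h3 : 0 ≤ ∑ i ∈ onAgents t, G.cost i := Finset.sum_nonneg fun i _ => G.cost_nonneg i
  have h4 : ∑ j ∈ G.uncoveredSets t, (G.sets j).card * G.weight j ≤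
      (K + 1) * ∑ j ∈ G.uncoveredSets t, G.weight j := by
    rw [Finset.mul_sum]
    refine Finset.sum_le_sum fun j _ => mul_le_mul_of_nonneg_right ?_ (G.weight_nonneg j)
    exact_mod_cast ((G.card_sets_le_Fmax j).trans hK).trans (Nat.le_succ K)
  have h5 : ∑ i ∈ onAgents t, G.cost i ≤ (K + 1) * ∑ i ∈ onAgents t, G.cost i := by
    nlinarith [(K.cast_nonneg : (0 : ℝ) ≤ K)]
  calc G.socialCost t
      ≤ (K + 1) * ((∑ i ∈ onAgents t, G.cost i) + ∑ j ∈ G.uncoveredSets t, G.weight j) := by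
        rw [socialCost_eq]; linarith
    _ ≤ _ := by gcongr; linarith

/-! ### The two phases of public service advertising -/

/-- In a state where the advertised on agents are on and the others play best responses, an on agent
that was not advertised is the only one that covers some set, and that set is uncovered in the
advertised strategy. -/
theorem card_onAgents_le {lo : ℝ} (hlo : 0 < lo) (hc : ∀ i, lo ≤ G.cost i) {sad s : Strategy n}
    (hon : ∀ i, sad i = true → s i = true)
    (hbr : ∀ i, sad i = false → s i = true → G.IsBestResponse s i) :
    (onAgents s).card ≤ (onAgents sad).card + (G.uncoveredSets sad).card := by
  have hex : ∀ i, sad i = false ∧ s i = true →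
      ∃ j, i ∈ G.sets j ∧ ∀ k ∈ G.sets j, s k = true → k = i := by
    rintro i ⟨h1, h2⟩
    by_contra hno
    push Not at hno
    have h3 := hbr i h1 h2 false
    rw [agentCost, if_pos h2, agentCost, if_neg (by simp), Finset.filter_eq_empty_iff.mpr,
      Finset.sum_empty] at h3
    · linarith [hc i]
    · rintro j - ⟨hij, hu⟩
      obtain ⟨k, hk, hsk, hki⟩ := hno j hij
      have := hu k hk
      rw [Function.update_of_ne hki, hsk] at this
      exact absurd this (by simp)
  have hsub : onAgents sad ⊆ onAgents s := fun i => by simpa using hon i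
  rw [← Finset.card_sdiff_add_card_eq_card hsub, add_comm]
  gcongr
  have hmem : ∀ i ∈ onAgents s \ onAgents sad, sad i = false ∧ s i = true := fun i hi => by
    simpa [and_comm] using hi
  have hex' : ∀ i : (onAgents s \ onAgents sad : Finset _), ∃ j, (i : Fin n) ∈ G.sets j ∧
      ∀ k ∈ G.sets j, s k = true → k = i := fun i => hex i (hmem i i.2)
  choose f hf1 hf2 using hex'
  rw [← Fintype.card_coe, ← Finset.card_univ]
  refine Finset.card_le_card_of_injOn f (fun i _ => ?_) fun i _ i' _ h => ?_
  · rw [Finset.mem_coe, mem_uncoveredSets]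
    refine ⟨⟨i, hf1 i⟩, fun k hk => ?_⟩
    by_contra hsk
    rw [Bool.not_eq_false] at hsk
    rw [hf2 i k hk (hon k hsk), (hmem i i.2).1] at hsk
    exact absurd hsk (by simp)
  · exact Subtype.ext (hf2 i' i (h ▸ hf1 i) (hmem i i.2).2)

/-- The set `A` of receptive agents *supports* agent `k`: in the advertised strategy, `k` is the
only possible on element of more than `Q` sets all of whose other elements are receptive. -/
def SupportsAgent (sad : Strategy n) (Q : ℕ) (A : Set (Fin n)) (k : Fin n) : Prop :=
  ∃ J : Finset (Fin m), Q < J.card ∧ ∀ j ∈ J, k ∈ G.sets j ∧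
    (∀ i ∈ G.sets j, sad i = true → i = k) ∧ ∀ i ∈ G.sets j, i ≠ k → i ∈ A

theorem eq_of_reflTransGen {free : Set (Fin n)} {s t : Strategy n}
    (h : Relation.ReflTransGen (G.BRStep free) s t) {i : Fin n} (hi : i ∉ free) : t i = s i := by
  induction h with
  | refl => rfl
  | tail _ hst ih =>
    obtain ⟨k, hk, -, ⟨a, rfl⟩, -⟩ := hst
    rw [← ih, Function.update_of_ne]
    rintro rfl
    exact hi hk

/-- If an advertised on agent were off at the end of the first phase, then the sets that it covers
together with receptive off agents would be uncovered, and their weight exceeds its cost. -/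
theorem PSAOutcome.eq_true_of_supportsAgent {sad : Strategy n} {A : Set (Fin n)}
    {s₀ s' s'' : Strategy n} {G : CoveringGame n m} (h : G.PSAOutcome sad A s₀ s' s'') {Q : ℕ}
    {lo hi : ℝ} (hlo : 0 ≤ lo) (hQ : hi < (Q + 1) * lo) (hc : ∀ i, G.cost i ≤ hi)
    (hw : ∀ j, lo ≤ G.weight j) {k : Fin n} (hk : sad k = true)
    (hA : G.SupportsAgent sad Q A k) :
    s' k = true := by
  have hadopt : ∀ i ∈ A, s' i = sad i := fun i hi => by
    rw [G.eq_of_reflTransGen h.phase1 (by simpa using hi), adopt, if_pos hi]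
  by_cases hkA : k ∈ A
  · rw [hadopt k hkA, hk]
  by_contra hoff
  obtain ⟨J, hJ, hJ'⟩ := hA
  have h1 := h.nash1 k hkA true
  rw [agentCost, if_neg hoff, agentCost, if_pos (by simp)] at h1
  have h2 : J.card • lo ≤ ∑ j with k ∈ G.sets j ∧ G.Uncovered s' j, G.weight j := by
    refine (Finset.card_nsmul_le_sum J G.weight lo fun j _ => hw j).trans
      (Finset.sum_le_sum_of_subset_of_nonneg (fun j hj => ?_) fun j _ _ => G.weight_nonneg j)
    obtain ⟨hkj, hsole, hrec⟩ := hJ' j hj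
    simp only [Finset.mem_filter, Finset.mem_univ, true_and]
    refine ⟨hkj, fun i hi => ?_⟩
    by_cases hik : i = k
    · subst hik; simpa using hoff
    · rw [hadopt i (hrec i hi hik)]
      by_contra hon
      exact hik (hsole i hi (by simpa using hon))
  rw [nsmul_eq_mul] at h2
  have h3 : ((Q : ℝ) + 1) * lo ≤ J.card * lo := by
    gcongr
    exact_mod_cast hJ
  linarith [hc k]

/-- The advertised on agents stay on, so that the potential at the end of the first phase is
controlled by the advertised strategy. -/
theorem PSAOutcome.socialCost_le_of_supports {sad : Strategy n} {A : Set (Fin n)}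
    {s₀ s' s'' : Strategy n} {G : CoveringGame n m} (h : G.PSAOutcome sad A s₀ s' s'') {K Q : ℕ}
    {lo hi : ℝ} (hK : G.Fmax ≤ K) (hlo : 0 < lo) (hhi : 0 ≤ hi) (hQ : hi < (Q + 1) * lo)
    (hc : ∀ i, lo ≤ G.cost i ∧ G.cost i ≤ hi) (hw : ∀ j, lo ≤ G.weight j ∧ G.weight j ≤ hi)
    (hA : ∀ k, sad k = true → G.SupportsAgent sad Q A k) :
    G.socialCost s'' ≤
      (K + 1) * (((onAgents sad).card + 2 * (G.uncoveredSets sad).card) * hi) := by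
  have hon : ∀ i, sad i = true → s' i = true := fun i hi =>
    h.eq_true_of_supportsAgent hlo.le hQ (fun i => (hc i).2) (fun j => (hw j).1) hi (hA i hi)
  have h1 := G.card_onAgents_le hlo (fun i => (hc i).1) hon fun i hi hi' => by
    refine h.nash1 i fun hiA => ?_
    rw [G.eq_of_reflTransGen h.phase1 (by simpa using hiA), adopt, if_pos hiA, hi] at hi'
    exact absurd hi' (by simp)
  have h2 : (G.uncoveredSets s').card ≤ (G.uncoveredSets sad).card := by
    refine Finset.card_le_card fun j hj => ?_
    rw [mem_uncoveredSets] at hj ⊢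
    refine ⟨hj.1, fun k hk => ?_⟩
    by_contra hsad
    have := hj.2 k hk
    rw [hon k (by simpa using hsad)] at this
    exact absurd this (by simp)
  refine (G.socialCost_le_of_reflTransGen hK (fun i => (hc i).2) (fun j => (hw j).2)
    h.phase2).trans ?_
  have h3 : (((onAgents s').card + (G.uncoveredSets s').card : ℕ) : ℝ) ≤
      ((onAgents sad).card + 2 * (G.uncoveredSets sad).card : ℕ) := by
    exact_mod_cast (by omega)
  push_cast at h3
  exact mul_le_mul_of_nonneg_left (mul_le_mul_of_nonneg_right h3 hhi) (by positivity)

end CoveringGame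

/-! ### Disjoint sets with a common unique on element -/

/-- A maximal pairwise disjoint subfamily, built greedily: each member of the family belongs to it
or meets one of its members. -/
theorem Finset.exists_maximal_pairwiseDisjoint {ι κ : Type*} [DecidableEq ι] [DecidableEq κ]
    (J : Finset κ) (f : κ → Finset ι) :
    ∃ T ⊆ J, (T : Set κ).PairwiseDisjoint f ∧ ∀ j ∈ J, j ∈ T ∨ ∃ t ∈ T, ¬ Disjoint (f t) (f j) := by
  induction J using Finset.induction_on with
  | empty => exact ⟨∅, by simp⟩
  | insert a J ha ih =>
    obtain ⟨T, hTJ, hT, hmax⟩ := ih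
    by_cases h : ∃ t ∈ T, ¬ Disjoint (f t) (f a)
    · refine ⟨T, hTJ.trans (Finset.subset_insert a J), hT, fun j hj => ?_⟩
      rcases Finset.mem_insert.mp hj with rfl | hj
      · exact Or.inr h
      · exact hmax j hj
    · push Not at h
      refine ⟨insert a T, Finset.insert_subset_insert a hTJ, ?_, fun j hj => ?_⟩
      · rw [Finset.coe_insert, Set.pairwiseDisjoint_insert]
        exact ⟨hT, fun j hj _ => (h j hj).symm⟩
      · rcases Finset.mem_insert.mp hj with rfl | hj
        · exact Or.inl (Finset.mem_insert_self _ _)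
        · rcases hmax j hj with hj | ⟨t, ht, htj⟩
          · exact Or.inl (Finset.mem_insert_of_mem hj)
          · exact Or.inr ⟨t, Finset.mem_insert_of_mem ht, htj⟩

namespace CoveringGame

variable {n m : ℕ} (G : CoveringGame n m)

/-- The sets that contain agent `i` as the unique on element. -/
def soleSets (s : Strategy n) (i : Fin n) : Finset (Fin m) :=
  {j | i ∈ G.sets j ∧ s i = true ∧ ∀ k ∈ G.sets j, s k = true → k = i}

/-- Since two agents share at most `Δ₂` sets, a maximal subfamily of `soleSets s k` that is disjoint
outside of `k` is large. -/
theorem exists_disjoint_soleSets {K N : ℕ} (hK : G.Fmax ≤ K) (hΔ : 1 ≤ G.Δ₂) (s : Strategy n)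
    (k : Fin n) (hN : N * ((K + 1) * G.Δ₂) ≤ G.soleCount s k) :
    ∃ T ⊆ G.soleSets s k, (T : Set (Fin m)).PairwiseDisjoint (fun j => (G.sets j).erase k) ∧
      N ≤ T.card := by
  obtain ⟨T, hTJ, hT, hmax⟩ := Finset.exists_maximal_pairwiseDisjoint (G.soleSets s k)
    fun j => (G.sets j).erase k
  refine ⟨T, hTJ, hT, ?_⟩
  have hcov : G.soleSets s k ⊆ T.biUnion fun t => {t} ∪ ((G.sets t).erase k).biUnion fun e =>
      {j | k ∈ G.sets j ∧ e ∈ G.sets j} := by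
    intro j hj
    rw [Finset.mem_biUnion]
    rcases hmax j hj with h | ⟨t, ht, h⟩
    · exact ⟨j, h, by simp⟩
    · obtain ⟨e, he, he'⟩ := Finset.not_disjoint_iff.mp h
      refine ⟨t, ht, Finset.mem_union_right _ (Finset.mem_biUnion.mpr ⟨e, he, ?_⟩)⟩
      simp only [soleSets, Finset.mem_filter, Finset.mem_univ, true_and] at hj ⊢
      exact ⟨hj.1, Finset.mem_of_mem_erase he'⟩
  have hcard : (G.soleSets s k).card ≤ T.card * ((K + 1) * G.Δ₂) := by
    refine (Finset.card_le_card hcov).trans (Finset.card_biUnion_le_card_mul _ _ _ fun t _ => ?_)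
    have h1 : (((G.sets t).erase k).biUnion fun e =>
        ({j | k ∈ G.sets j ∧ e ∈ G.sets j} : Finset (Fin m))).card ≤ K * G.Δ₂ := by
      refine (Finset.card_biUnion_le_card_mul _ _ G.Δ₂ fun e he => ?_).trans
        (Nat.mul_le_mul_right _ ?_)
      · exact G.card_filter_le_Δ₂ (Finset.ne_of_mem_erase he).symm
      · exact (Finset.card_le_card (Finset.erase_subset _ _)).trans
          ((G.card_sets_le_Fmax t).trans hK)
    refine (Finset.card_union_le _ _).trans ?_
    rw [Finset.card_singleton]
    linarith
  exact Nat.le_of_mul_le_mul_right (hN.trans hcard) (by positivity)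

/-- The disjoint sets that agent `k` alone covers are split into `Q + 1` groups of size `r`. If each
group has a set whose other elements are all receptive, then these sets support `k`. -/
theorem setBernoulli_not_supportsAgent_le (α : unitInterval) {K Q r : ℕ} (hK : G.Fmax ≤ K)
    (hΔ : 1 ≤ G.Δ₂) (s : Strategy n) (k : Fin n)
    (hN : (Q + 1) * r * ((K + 1) * G.Δ₂) ≤ G.soleCount s k) :
    (setBernoulli (Set.univ : Set (Fin n)) α).real {A | ¬ G.SupportsAgent s Q A k} ≤
      (Q + 1) * (1 - (α : ℝ) ^ (K + 1)) ^ r := by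
  obtain ⟨T, hT, hdis, hcard⟩ := G.exists_disjoint_soleSets hK hΔ s k hN
  obtain ⟨g⟩ : Nonempty (Fin (Q + 1) × Fin r ↪ T) :=
    Function.Embedding.nonempty_of_card_le (by simpa using hcard)
  have hα0 : (0 : ℝ) ≤ α := α.2.1
  have hα1 : (α : ℝ) ≤ 1 := α.2.2
  have hgroup : ∀ a, (setBernoulli (Set.univ : Set (Fin n)) α).real
      {A | ∀ b ∈ Finset.univ, ¬ (((G.sets (g (a, b))).erase k : Finset (Fin n)) : Set (Fin n)) ⊆ A}
        ≤ (1 - (α : ℝ) ^ (K + 1)) ^ r := by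
    intro a
    rw [setBernoulli_real_forall_not_superset α Finset.univ
      (fun b => (G.sets (g (a, b))).erase k) (fun b _ c _ hbc => hdis (g (a, b)).2 (g (a, c)).2
        fun h => hbc (congrArg Prod.snd (g.injective (Subtype.ext h))))]
    refine (Finset.prod_le_prod (fun b _ => sub_nonneg.mpr (pow_le_one₀ hα0 hα1))
      fun b _ => ?_).trans_eq (b := ∏ _b : Fin r, (1 - (α : ℝ) ^ (K + 1))) (by simp)
    refine sub_le_sub_left (pow_le_pow_of_le_one hα0 hα1 ?_) 1
    exact (Finset.card_le_card (Finset.erase_subset _ _)).trans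
      ((G.card_sets_le_Fmax _).trans (hK.trans (Nat.le_succ K)))
  have hbad : {A | ¬ G.SupportsAgent s Q A k} ⊆ ⋃ a ∈ (Finset.univ : Finset (Fin (Q + 1))),
      {A | ∀ b ∈ Finset.univ,
        ¬ (((G.sets (g (a, b))).erase k : Finset (Fin n)) : Set (Fin n)) ⊆ A} := by
    intro A hA
    contrapose! hA
    simp only [Set.mem_iUnion, not_exists, Set.mem_ofPred_eq, not_forall, not_not,
      Finset.mem_univ, forall_const, exists_prop, true_and] at hA
    simp only [Set.mem_ofPred_eq, not_not]
    choose b hb using hA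
    refine ⟨Finset.univ.image fun a => (g (a, b a) : Fin m), ?_, ?_⟩
    · rw [Finset.card_image_of_injective _
        fun a a' h => congrArg Prod.fst (g.injective (Subtype.ext h))]
      simp
    · intro j hj
      obtain ⟨a, -, rfl⟩ := Finset.mem_image.mp hj
      have hsole := hT (g (a, b a)).2
      simp only [soleSets, Finset.mem_filter, Finset.mem_univ, true_and] at hsole
      exact ⟨hsole.1, hsole.2.2, fun i hi hik => hb a (by simp [hi, hik])⟩
  refine (MeasureTheory.measureReal_mono hbad (MeasureTheory.measure_ne_top _ _)).trans ?_
  refine (MeasureTheory.measureReal_biUnion_finset_le _ _).trans ?_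
  refine (Finset.sum_le_card_nsmul _ _ _ fun a _ => hgroup a).trans_eq ?_
  simp

/-- Union bound over the on agents. -/
theorem one_sub_le_setBernoulli_supports (α : unitInterval) {K Q r : ℕ} (hK : G.Fmax ≤ K)
    (hΔ : 1 ≤ G.Δ₂) (s : Strategy n)
    (hN : ∀ k, s k = true → (Q + 1) * r * ((K + 1) * G.Δ₂) ≤ G.soleCount s k) :
    1 - n * ((Q + 1) * (1 - (α : ℝ) ^ (K + 1)) ^ r) ≤
      (setBernoulli (Set.univ : Set (Fin n)) α).real
        {A | ∀ k, s k = true → G.SupportsAgent s Q A k} := by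
  have hα0 : (0 : ℝ) ≤ α := α.2.1
  have hα1 : (α : ℝ) ≤ 1 := α.2.2
  have hβ0 : 0 ≤ 1 - (α : ℝ) ^ (K + 1) := sub_nonneg.mpr (pow_le_one₀ hα0 hα1)
  have hbad : {A | ∀ k, s k = true → G.SupportsAgent s Q A k}ᶜ ⊆
      ⋃ k ∈ onAgents s, {A | ¬ G.SupportsAgent s Q A k} := by
    intro A hA
    simpa using hA
  have hle : (setBernoulli (Set.univ : Set (Fin n)) α).real
      {A | ∀ k, s k = true → G.SupportsAgent s Q A k}ᶜ ≤
        n * ((Q + 1) * (1 - (α : ℝ) ^ (K + 1)) ^ r) := by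
    refine (MeasureTheory.measureReal_mono hbad (MeasureTheory.measure_ne_top _ _)).trans ?_
    refine (MeasureTheory.measureReal_biUnion_finset_le _ _).trans ?_
    refine (Finset.sum_le_card_nsmul _ _ _ fun k hk => G.setBernoulli_not_supportsAgent_le α hK hΔ
      s k (hN k (by simpa using hk))).trans ?_
    rw [nsmul_eq_mul]
    gcongr
    exact (Finset.card_le_univ _).trans_eq (by simp)
  rw [MeasureTheory.probReal_compl_eq_one_sub .of_discrete] at hle
  linarith

/-- The condition `(⋆)` only becomes easier to satisfy when the largest set, the quotient of costs
and weights, and `x` are replaced by bounds for them. -/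
theorem star_of_le_soleCount {α : ℝ} (hα0 : 0 < α) (hα1 : α < 1) {K Q a : ℕ} {lo hi ℓ r : ℝ}
    (hℓ : 0 ≤ ℓ) (hlo : 0 < lo)
    (hK : G.Fmax ≤ K) (hΔ : 1 ≤ G.Δ₂) (hQ : hi < (Q + 1) * lo)
    (hc : ∀ i, lo ≤ G.cost i ∧ G.cost i ≤ hi) (hw : ∀ j, lo ≤ G.weight j ∧ G.weight j ≤ hi)
    (ha : ∀ x : ℝ, a * (ℓ + 1) ≤ x →
      1 ≤ x ∧ Q ≤ x ∧ Q * x ^ Q * (1 - α ^ (K + 1)) ^ (x - Q) ≤ 1 / (n : ℝ) ^ 2)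
    (har : a * (ℓ + 1) ≤ r) {s : Strategy n}
    (hN : ∀ k, s k = true → r * ((K + 1) * G.Δ₂) ≤ G.soleCount s k) : G.Star α s := by
  intro x d hd hx
  have hn : Nonempty (Fin n) := by
    by_contra h
    rw [not_nonempty_iff] at h
    simp [Δ₂] at hΔ
  have hm : Nonempty (Fin m) := by
    by_contra h
    rw [not_nonempty_iff] at h
    simp [Δ₂] at hΔ
  have hF : 2 ≤ G.Fmax := by
    by_contra hF
    have : G.Δ₂ ≤ 0 := by
      refine Finset.sup_le fun p _ => (Finset.card_eq_zero.mpr ?_).le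
      refine Finset.filter_eq_empty_iff.mpr ?_
      rintro j - ⟨hne, h1, h2⟩
      exact hF ((Finset.one_lt_card.mpr ⟨_, h1, _, h2, hne⟩).trans_le (G.card_sets_le_Fmax j))
    omega
  have hF' : (2 : ℝ) ≤ G.Fmax := by exact_mod_cast hF
  have hK' : (G.Fmax : ℝ) ≤ K := by exact_mod_cast hK
  have hΔ' : (1 : ℝ) ≤ G.Δ₂ := by exact_mod_cast hΔ
  -- if nobody is on, then `coreMinDegree` is `⊤` and there is nothing to prove
  have hrd : r * ((K + 1) * G.Δ₂) ≤ d := by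
    have hsome : ∃ i, s i = true ∧ G.soleCount s i = d := by
      have hne : Set.Nonempty {i | s i = true} := by
        by_contra hne
        rw [Set.not_nonempty_iff_eq_empty, Set.eq_empty_iff_forall_notMem] at hne
        have : G.coreMinDegree s = ⊤ := by
          simp only [coreMinDegree, iInf_eq_top]
          exact fun i hi => absurd hi (hne i)
        rw [this] at hd
        exact ENat.top_ne_natCast d hd
      have : (G.coreMinDegree s) ∈ (fun i => (G.soleCount s i : ℕ∞)) '' {i | s i = true} := by
        have := csInf_mem (hne.image fun i => (G.soleCount s i : ℕ∞))
        rwa [sInf_image] at this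
      obtain ⟨i, hi, h⟩ := this
      exact ⟨i, hi, by rw [hd] at h; exact ENat.natCast_inj.mp h⟩
    obtain ⟨i, hi, h⟩ := hsome
    rw [← h]
    exact hN i hi
  have hr0 : 0 ≤ r := le_trans (by positivity) har
  have hrx : r ≤ x := by
    refine le_trans ?_ hx
    rw [le_div_iff₀ (mul_pos (by linarith) (by linarith))]
    refine le_trans (mul_le_mul_of_nonneg_left ?_ hr0) hrd
    rw [mul_comm]
    exact mul_le_mul_of_nonneg_right (by linarith) (by linarith)
  obtain ⟨hx1, hxQ, hxa⟩ := ha x (har.trans hrx)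
  have hwmin : lo ≤ G.wmin := le_ciInf fun j => (hw j).1
  have hcmax : G.cmax ≤ hi := ciSup_le fun i => (hc i).2
  have hq : ⌊G.cmax / G.wmin⌋₊ ≤ Q := by
    rw [← Nat.lt_succ_iff, Nat.floor_lt' (by simp), div_lt_iff₀ (by linarith)]
    push_cast
    have : ((Q : ℝ) + 1) * lo ≤ (Q + 1) * G.wmin := by gcongr
    linarith
  have hq' : (⌊G.cmax / G.wmin⌋₊ : ℝ) ≤ Q := by exact_mod_cast hq
  have hβ : 1 - α ^ G.Fmax ≤ 1 - α ^ (K + 1) :=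
    sub_le_sub_left (pow_le_pow_of_le_one hα0.le hα1.le (by omega)) 1
  have hβ0 : 0 ≤ 1 - α ^ G.Fmax := sub_nonneg.mpr (pow_le_one₀ hα0.le hα1.le)
  have hβ1 : 0 < 1 - α ^ (K + 1) := sub_pos.mpr (pow_lt_one₀ hα0.le hα1 (by simp))
  have hβ2 : 1 - α ^ (K + 1) ≤ 1 := by linarith [pow_pos hα0 (K + 1)]
  refine le_trans ?_ hxa
  refine mul_le_mul (mul_le_mul hq' (pow_le_pow_right₀ hx1 hq) (by positivity) (by positivity))
    ?_ (Real.rpow_nonneg hβ0 _) (by positivity)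
  calc (1 - α ^ G.Fmax) ^ (x - (⌊G.cmax / G.wmin⌋₊ : ℝ))
      ≤ (1 - α ^ (K + 1)) ^ (x - (⌊G.cmax / G.wmin⌋₊ : ℝ)) :=
        Real.rpow_le_rpow hβ0 hβ (by linarith)
    _ ≤ _ := Real.rpow_le_rpow_of_exponent_ge hβ1 hβ2 (by linarith)

end CoveringGame

/-! ### Guarantees for pruned strategies -/

namespace CoveringGame

variable {n m : ℕ} (G : CoveringGame n m)

theorem one_lt_of_one_le_Δ₂ (h : 1 ≤ G.Δ₂) : 1 < n := by
  by_contra hn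
  have : Subsingleton (Fin n) := Fin.subsingleton_iff_le_one.mpr (by omega)
  have : G.Δ₂ ≤ 0 := Finset.sup_le fun p _ => (Finset.card_eq_zero.mpr
    (Finset.filter_eq_empty_iff.mpr fun j _ hj => hj.1 (Subsingleton.elim _ _))).le
  omega

/-- What the algorithm achieves: `s` has at most `K` on agents and at most `D * K` uncovered
nonempty sets for each member of a family of disjoint nonempty sets, and each on agent is the
unique on element of at least `D` sets. -/
structure IsPruned (K D : ℕ) (s : Strategy n) : Prop where
  exists_disjoint : ∃ T : Finset (Fin m), (T : Set (Fin m)).PairwiseDisjoint G.sets ∧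
    (∀ j ∈ T, (G.sets j).Nonempty) ∧ (onAgents s).card ≤ K * T.card ∧
    (G.uncoveredSets s).card ≤ D * (K * T.card)
  le_soleCount : ∀ i, s i = true → D ≤ G.soleCount s i

/-- The second bound is the one that `PSAOutcome.socialCost_le_of_supports` gives for the final
state. -/
theorem IsPruned.cost_bounds {G : CoveringGame n m} {K D : ℕ} {s : Strategy n}
    (h : G.IsPruned K D s) (hD : 1 ≤ D) {lo hi : ℝ} (hK : G.Fmax ≤ K) (hlo : 0 < lo) (hhi : 0 ≤ hi)
    (hc : ∀ i, lo ≤ G.cost i ∧ G.cost i ≤ hi) (hw : ∀ j, lo ≤ G.weight j ∧ G.weight j ≤ hi) :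
    G.socialCost s ≤ 3 * (K + 1) ^ 2 * hi / lo * D * G.opt ∧
      (K + 1) * (((onAgents s).card + 2 * (G.uncoveredSets s).card) * hi) ≤
        3 * (K + 1) ^ 2 * hi / lo * D * G.opt := by
  obtain ⟨T, hT, hne, h1, h2⟩ := h.exists_disjoint
  have hopt := G.card_mul_le_opt (fun i => (hc i).1) (fun j => (hw j).1) T hT hne
  have hb : (K + 1) * (((onAgents s).card + 2 * (G.uncoveredSets s).card) * hi) ≤
      3 * (K + 1) ^ 2 * hi / lo * D * G.opt := by
    have h3 : (onAgents s).card + 2 * (G.uncoveredSets s).card ≤ 3 * D * ((K + 1) * T.card) := by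
      have h4 : K * T.card ≤ D * (K * T.card) := Nat.le_mul_of_pos_left _ hD
      have h5 : 3 * D * (K * T.card) ≤ 3 * D * ((K + 1) * T.card) := by gcongr; omega
      linarith
    have h6 : ((onAgents s).card : ℝ) + 2 * (G.uncoveredSets s).card ≤
        3 * D * ((K + 1) * T.card) := by exact_mod_cast h3
    calc (K + 1) * (((onAgents s).card + 2 * (G.uncoveredSets s).card) * hi)
        ≤ (K + 1) * ((3 * D * ((K + 1) * T.card)) * hi) := by gcongr
      _ = 3 * (K + 1) ^ 2 * hi / lo * D * (T.card * lo) := by field_simp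
      _ ≤ _ := by gcongr
  refine ⟨(G.socialCost_le hK (fun i => (hc i).2) (fun j => (hw j).2) s).trans (le_trans ?_ hb), hb⟩
  have h7 : (0 : ℝ) ≤ K := K.cast_nonneg
  have h8 : 0 ≤ ((onAgents s).card : ℝ) * hi := by positivity
  have h9 : 0 ≤ ((G.uncoveredSets s).card : ℝ) * hi := by positivity
  have h10 : 0 ≤ (K : ℝ) * (((onAgents s).card : ℝ) * hi) := by positivity
  have h11 : 0 ≤ (K : ℝ) * (((G.uncoveredSets s).card : ℝ) * hi) := by positivity
  linarith

/-- A pruning threshold of order `Δ₂ * log n` yields all three guarantees. -/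
theorem exists_pruning_threshold (α : unitInterval) (hα0 : 0 < α) (hα1 : α < 1) (K : ℕ)
    (lo hi : ℝ) (hlo : 0 < lo) :
    ∃ (c₀ : ℕ) (C : ℝ), ∀ (n m : ℕ) (G : CoveringGame n m), G.Fmax ≤ K →
      (∀ i, lo ≤ G.cost i ∧ G.cost i ≤ hi) → (∀ j, lo ≤ G.weight j ∧ G.weight j ≤ hi) →
      1 ≤ G.Δ₂ → ∀ s, G.IsPruned K (c₀ * G.Δ₂ * (Nat.clog 2 n + 1)) s →
        G.Star (α : ℝ) s ∧
        G.socialCost s ≤ C * (G.Δ₂ * Real.log n) * G.opt ∧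
        1 - 1 / (n : ℝ) ≤ G.probFinalCostLE α s (C * (G.Δ₂ * Real.log n) * G.opt) := by
  have hα0' : (0 : ℝ) < α := hα0
  have hα1' : (α : ℝ) < 1 := hα1
  set Q := ⌊hi / lo⌋₊ with hQdef
  have hQ : hi < (Q + 1) * lo := by
    rw [← div_lt_iff₀ hlo]
    exact Nat.lt_floor_add_one _
  obtain ⟨a, ha1, ha⟩ := exists_threshold (β := 1 - (α : ℝ) ^ (K + 1))
    (sub_pos.mpr (pow_lt_one₀ hα0'.le hα1' (by simp))) (by linarith [pow_pos hα0' (K + 1)]) Q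
  refine ⟨(K + 1) * (Q + 1) * a, 18 * (K + 1) ^ 2 * hi / lo * ((K + 1) * (Q + 1) * a),
    fun n m G hK hc hw hΔ s hs => ?_⟩
  have hn : 1 < n := G.one_lt_of_one_le_Δ₂ hΔ
  have hhi : 0 ≤ hi := hlo.le.trans ((hc ⟨0, by omega⟩).1.trans (hc ⟨0, by omega⟩).2)
  have hn' : (1 : ℝ) < n := by exact_mod_cast hn
  have hlog : 0 < Real.log n := Real.log_pos hn'
  have hexp : Real.exp (-(2 * Real.log n)) = 1 / (n : ℝ) ^ 2 := by
    rw [Real.exp_neg, two_mul, Real.exp_add, Real.exp_log (by linarith), one_div, sq]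
  have hlog2 : 1 / 2 ≤ Real.log 2 := by linarith [Real.log_two_gt_d9]
  have hlog2' : Real.log 2 ≤ 1 := by linarith [Real.log_two_lt_d9]
  have hl1 : Real.log n + 1 ≤ Nat.clog 2 n + 1 := by
    have h1 : (n : ℝ) ≤ 2 ^ Nat.clog 2 n := by exact_mod_cast Nat.le_pow_clog (by norm_num) n
    have h2 := Real.log_le_log (by linarith) h1
    rw [Real.log_pow] at h2
    nlinarith [(Nat.cast_nonneg (Nat.clog 2 n) : (0 : ℝ) ≤ _)]
  have hl2 : (Nat.clog 2 n : ℝ) + 1 ≤ 6 * Real.log n := by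
    have h1 : ((2 : ℕ) ^ (Nat.clog 2 n).pred : ℕ) < n := Nat.pow_pred_clog_lt_self (by norm_num) hn
    have h2 : ((2 : ℝ) ^ (Nat.clog 2 n).pred) ≤ n := by exact_mod_cast h1.le
    have h3 := Real.log_le_log (by positivity) h2
    rw [Real.log_pow] at h3
    have h4 : (Nat.clog 2 n : ℝ) = (Nat.clog 2 n).pred + 1 := by
      have := Nat.clog_pos (b := 2) (by norm_num) hn
      exact_mod_cast (Nat.succ_pred_eq_of_pos this).symm
    have h5 : Real.log 2 ≤ Real.log n := Real.log_le_log (by norm_num) (by exact_mod_cast hn)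
    have h6 : ((Nat.clog 2 n).pred : ℝ) * (1 / 2) ≤ (Nat.clog 2 n).pred * Real.log 2 := by gcongr
    linarith
  set l := Nat.clog 2 n with hl
  have hΔ' : (1 : ℝ) ≤ G.Δ₂ := by exact_mod_cast hΔ
  have hN : ∀ k, s k = true →
      (Q + 1) * (a * (l + 1)) * ((K + 1) * G.Δ₂) ≤ G.soleCount s k := fun k hk => by
    refine le_of_eq_of_le ?_ (hs.le_soleCount k hk)
    ring
  obtain ⟨hcost1, hcost2⟩ := hs.cost_bounds (by
    have : 1 ≤ (K + 1) * (Q + 1) * a := Nat.mul_pos (by positivity) ha1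
    exact Nat.mul_pos (Nat.mul_pos this hΔ) (by positivity)) hK hlo hhi hc hw
  have hopt : 0 ≤ G.opt := Finset.le_inf' _ _ fun s _ =>
    Finset.sum_nonneg fun i _ => G.agentCost_nonneg s i
  have hC : 3 * (K + 1 : ℝ) ^ 2 * hi / lo * ((K + 1) * (Q + 1) * a * G.Δ₂ * (l + 1) : ℕ) * G.opt ≤
      18 * (K + 1) ^ 2 * hi / lo * ((K + 1) * (Q + 1) * a) * (G.Δ₂ * Real.log n) * G.opt := by
    refine mul_le_mul_of_nonneg_right ?_ hopt
    push_cast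
    calc 3 * (K + 1 : ℝ) ^ 2 * hi / lo * ((K + 1) * (Q + 1) * a * G.Δ₂ * (l + 1))
        ≤ 3 * (K + 1 : ℝ) ^ 2 * hi / lo * ((K + 1) * (Q + 1) * a * G.Δ₂ * (6 * Real.log n)) := by
          gcongr
      _ = _ := by ring
  have har : (a : ℝ) * (Real.log n + 1) ≤ (a * (l + 1) : ℕ) := by
    push_cast
    gcongr
  refine ⟨G.star_of_le_soleCount hα0' hα1' (ℓ := Real.log n) (r := (a * (l + 1) : ℕ)) hlog.le hlo
    hK hΔ hQ hc hw ?_ har fun k hk => ?_, hcost1.trans hC, ?_⟩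
  · intro x hx
    obtain ⟨h1, h2, h3, -⟩ := ha (Real.log n) x hlog.le hx
    exact ⟨h1, h2, h3.trans_eq hexp⟩
  · refine le_trans ?_ (Nat.cast_le.mpr (hN k hk))
    push_cast
    refine mul_le_mul_of_nonneg_right ?_ (by positivity)
    have : (0 : ℝ) ≤ Q * (a * (l + 1)) := by positivity
    linarith
  · have hprob := G.one_sub_le_setBernoulli_supports α hK hΔ s hN
    obtain ⟨-, -, -, h4⟩ := ha (Real.log n) (a * (l + 1) : ℕ) hlog.le har
    rw [Real.rpow_natCast, hexp] at h4
    have h5 : n * ((Q + 1) * (1 - (α : ℝ) ^ (K + 1)) ^ (a * (l + 1))) ≤ 1 / n := by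
      calc n * ((Q + 1) * (1 - (α : ℝ) ^ (K + 1)) ^ (a * (l + 1))) ≤ n * (1 / (n : ℝ) ^ 2) := by
            gcongr
        _ = 1 / n := by field_simp
    refine (sub_le_sub_left h5 1).trans (hprob.trans (MeasureTheory.measureReal_mono ?_
      (MeasureTheory.measure_ne_top _ _)))
    intro A hA s₀ s' s'' hout
    exact (hout.socialCost_le_of_supports hK hlo hhi hQ hc hw hA).trans (hcost2.trans hC)

end CoveringGame

/-! ### Reasoning about programs -/

namespace RAM

/-- Started on `σ`, the program `c` halts within `T` steps, in a memory that satisfies `Q`. -/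
def HaltsWithin (c : Cmd) (σ : Store) (T : ℕ) (Q : Store → Prop) : Prop :=
  ∃ t σ', Runs c σ t σ' ∧ t ≤ T ∧ Q σ'

namespace HaltsWithin

variable {c d : Cmd} {σ : Store} {T T₁ T₂ : ℕ} {Q R : Store → Prop}

theorem mono (h : HaltsWithin c σ T Q) (hQ : ∀ σ', Q σ' → R σ') : HaltsWithin c σ T R :=
  let ⟨t, σ', h1, h2, h3⟩ := h
  ⟨t, σ', h1, h2, hQ σ' h3⟩

theorem skip (hT : 1 ≤ T) (hQ : Q σ) : HaltsWithin .skip σ T Q := ⟨1, σ, .skip σ, hT, hQ⟩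

theorem setReg {x : ℕ} {e : NExpr} (hT : e.time + 1 ≤ T)
    (hQ : Q { σ with reg := Function.update σ.reg x (e.eval σ) }) :
    HaltsWithin (.setReg x e) σ T Q := ⟨_, _, .setReg x e σ, hT, hQ⟩

theorem setArr {a : ℕ} {idx e : NExpr} (hT : idx.time + e.time + 1 ≤ T)
    (hQ : Q { σ with
      arr := Function.update σ.arr a (Function.update (σ.arr a) (idx.eval σ) (e.eval σ)) }) :
    HaltsWithin (.setArr a idx e) σ T Q := ⟨_, _, .setArr a idx e σ, hT, hQ⟩

theorem seq (h : HaltsWithin c σ T₁ fun σ₁ => HaltsWithin d σ₁ T₂ Q) :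
    HaltsWithin (.seq c d) σ (T₁ + T₂) Q := by
  obtain ⟨t₁, σ₁, h1, ht1, t₂, σ₂, h2, ht2, hQ⟩ := h
  exact ⟨_, _, .seq h1 h2, add_le_add ht1 ht2, hQ⟩

theorem branch {b : Test} (hT : b.time ≤ T₁) (h1 : b.Holds σ → HaltsWithin c σ T₂ Q)
    (h2 : ¬ b.Holds σ → HaltsWithin d σ T₂ Q) : HaltsWithin (.branch b c d) σ (T₁ + T₂) Q := by
  by_cases hb : b.Holds σ
  · obtain ⟨t, σ', h, ht, hQ⟩ := h1 hb
    exact ⟨_, _, .branch_true hb h, add_le_add hT ht, hQ⟩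
  · obtain ⟨t, σ', h, ht, hQ⟩ := h2 hb
    exact ⟨_, _, .branch_false hb h, add_le_add hT ht, hQ⟩

end HaltsWithin

/-- `for x = 0, …, y - 1 do c`, with the numbers held in registers. -/
def Cmd.forLoop (x y : ℕ) (c : Cmd) : Cmd :=
  .seq (.setReg x (.const 0))
    (.loop (.lt (.reg x) (.reg y)) (.seq c (.setReg x (.add (.reg x) (.const 1)))))

/-- The rule for `for` loops: the body takes the invariant `I k` to `I (k + 1)`, up to the update of
the loop counter. -/
theorem HaltsWithin.forLoop {x y N T : ℕ} {c : Cmd} {σ : Store} (I : ℕ → Store → Prop)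
    (h0 : I 0 { σ with reg := Function.update σ.reg x 0 })
    (hI : ∀ k ≤ N, ∀ τ, I k τ → τ.reg x = k ∧ τ.reg y = N)
    (hstep : ∀ k < N, ∀ τ, I k τ → HaltsWithin c τ T fun τ' =>
      τ'.reg x = k ∧ I (k + 1) { τ' with reg := Function.update τ'.reg x (k + 1) }) :
    HaltsWithin (.forLoop x y c) σ ((N + 1) * (T + 7)) (I N) := by
  have hloop : ∀ l k, k + l = N → ∀ τ, I k τ → HaltsWithin
      (.loop (.lt (.reg x) (.reg y)) (.seq c (.setReg x (.add (.reg x) (.const 1))))) τ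
      (l * (T + 7) + 3) (I N) := by
    intro l
    induction l with
    | zero =>
      intro k hk τ hτ
      obtain rfl : k = N := by omega
      obtain ⟨h1, h2⟩ := hI k le_rfl τ hτ
      refine ⟨_, τ, .loop_false ?_, ?_, hτ⟩
      · simp [Test.Holds, NExpr.eval, h1, h2]
      · simp [Test.time, NExpr.time]
    | succ l ih =>
      intro k hk τ hτ
      obtain ⟨h1, h2⟩ := hI k (by omega) τ hτ
      obtain ⟨t, τ', hrun, ht, hx, hI'⟩ := hstep k (by omega) τ hτ
      obtain ⟨t', τ'', hrun', ht', hQ⟩ := ih (k + 1) (by omega) _ hI'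
      refine ⟨_, τ'', .loop_true (t₂ := t') ?_ (.seq hrun (.setReg _ _ _)) ?_, ?_, hQ⟩
      · simp [Test.Holds, NExpr.eval, h1, h2]
        omega
      · simpa [NExpr.eval, hx] using hrun'
      · simp only [Test.time, NExpr.time]
        linarith
  obtain ⟨t, τ, h1, h2, h3⟩ := hloop N 0 (by omega) _ h0
  refine ⟨_, τ, .seq (.setReg _ _ _) h1, ?_, h3⟩
  simp only [NExpr.time]
  linarith

/-- Count in register `z` for how many `x = 0, …, y - 1` the test holds. -/
def Cmd.countLoop (x y z : ℕ) (b : Test) : Cmd :=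
  .seq (.setReg z (.const 0))
    (.forLoop x y (.branch b (.setReg z (.add (.reg z) (.const 1))) .skip))

theorem HaltsWithin.countLoop {x y z N : ℕ} {b : Test} {σ : Store} (hxy : x ≠ y) (hxz : x ≠ z)
    (hyz : y ≠ z) (hy : σ.reg y = N) (p : Fin N → Prop) [DecidablePred p]
    (hb : ∀ (k : Fin N) (v : ℕ), b.Holds
      { σ with reg := Function.update (Function.update σ.reg z v) x k } ↔ p k)
    {Q : Store → Prop} (hQ : Q { σ with
      reg := Function.update (Function.update σ.reg z (Finset.univ.filter p).card) x N }) :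
    HaltsWithin (.countLoop x y z b) σ (2 + (N + 1) * (b.time + 11)) Q := by
  refine HaltsWithin.seq (HaltsWithin.setReg le_rfl ?_)
  -- the invariant: register `z` holds the count over the indices below `k`
  have hcount : ∀ k (hk : k < N),
      (Finset.univ.filter fun i : Fin N => p i ∧ (i : ℕ) < k + 1).card =
        (Finset.univ.filter fun i : Fin N => p i ∧ (i : ℕ) < k).card +
          if p ⟨k, hk⟩ then 1 else 0 := by
    intro k hk
    split_ifs with hp
    · rw [← Finset.card_insert_of_notMem (a := (⟨k, hk⟩ : Fin N)) (by simp)]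
      congr 1
      ext i
      simp only [Finset.mem_filter, Finset.mem_univ, true_and, Finset.mem_insert, Fin.ext_iff,
        Nat.lt_succ_iff_lt_or_eq]
      constructor
      · rintro ⟨h1, h2 | h2⟩ <;> tauto
      · rintro (h | h)
        · obtain rfl : i = ⟨k, hk⟩ := Fin.ext h
          exact ⟨hp, Or.inr rfl⟩
        · tauto
    · rw [add_zero]
      congr 1
      ext i
      simp only [Finset.mem_filter, Finset.mem_univ, true_and, Nat.lt_succ_iff_lt_or_eq]
      constructor
      · rintro ⟨h1, h2 | h2⟩
        · exact ⟨h1, h2⟩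
        · obtain rfl : i = ⟨k, hk⟩ := Fin.ext h2
          exact absurd h1 hp
      · tauto
  refine HaltsWithin.mono (HaltsWithin.forLoop (T := b.time + 4) (N := N) (fun k τ => τ =
    { σ with
      reg := Function.update (Function.update σ.reg z
        (Finset.univ.filter fun i : Fin N => p i ∧ (i : ℕ) < k).card) x k }) ?_ ?_ ?_) ?_
  · simp [NExpr.eval]
  · rintro k - τ rfl
    simp [Function.update_of_ne hxy.symm, Function.update_of_ne hyz, hy]
  · rintro k hk τ rfl
    refine HaltsWithin.branch le_rfl (fun h => ?_) fun h => ?_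
    · have hp : p ⟨k, hk⟩ := (hb ⟨k, hk⟩ _).mp h
      refine HaltsWithin.setReg (by simp [NExpr.time]) ?_
      simp only [NExpr.eval, Function.update_of_ne hxz, Function.update_of_ne hxz.symm,
        Function.update_self, true_and, hcount k hk, if_pos hp]
      congr 1
      funext w
      by_cases hw : w = x
      · subst hw; simp
      · by_cases hw' : w = z
        · subst hw'; simp [hw]
        · simp [hw, hw']
    · have hp : ¬ p ⟨k, hk⟩ := fun hp => h ((hb ⟨k, hk⟩ _).mpr hp)
      refine HaltsWithin.skip (by simp) ?_
      simp only [hcount k hk, if_neg hp, add_zero, Function.update_self, Function.update_idem,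
        and_self]
  · rintro τ rfl
    simpa using hQ

end RAM

/-! ### Input, pair degrees and threshold -/

namespace CoveringGame

variable {n m : ℕ} (G : CoveringGame n m)

/-- The memory `σ` represents the game and the joint strategy `s`: as in the input, `n` and `m` are
in registers `0` and `1` and the incidence matrix is in array `0`; cell `j` of array `2` is the
position at which row `j` of that matrix starts, and `s` is in array `1`. -/
structure Represents (σ : RAM.Store) (s : Strategy n) : Prop where
  reg_zero : σ.reg 0 = n
  reg_one : σ.reg 1 = m
  incidence : ∀ (j : Fin m) (i : Fin n), σ.arr 0 (σ.arr 2 j + i) = if i ∈ G.sets j then 1 else 0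
  strategy : ∀ i : Fin n, σ.arr 1 i = if s i = true then 1 else 0

variable {G} in
theorem Represents.of_arr_eq {σ τ : RAM.Store} {s : Strategy n} (h : G.Represents σ s)
    (h0 : τ.reg 0 = σ.reg 0) (h1 : τ.reg 1 = σ.reg 1) (ha : τ.arr = σ.arr) : G.Represents τ s :=
  ⟨h0 ▸ h.reg_zero, h1 ▸ h.reg_one, ha ▸ h.incidence, ha ▸ h.strategy⟩

theorem inputStore_arr_zero (j : Fin m) (i : Fin n) :
    G.inputStore.arr 0 (j * n + i) = if i ∈ G.sets j then 1 else 0 := by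
  have h : (∃ (j' : Fin m) (i' : Fin n), (j : ℕ) * n + i = j' * n + i' ∧ i' ∈ G.sets j') ↔
      i ∈ G.sets j := by
    constructor
    · rintro ⟨j', i', h, hi⟩
      have hn : 0 < n := i.pos
      have h1 : (j : ℕ) = j' := by
        have := congrArg (· / n) h
        simpa [Nat.mul_add_div hn, mul_comm _ n, Nat.div_eq_of_lt] using this
      have h2 : (i : ℕ) = i' := by rw [h1] at h; omega
      rwa [Fin.ext h1, Fin.ext h2]
    · exact fun hi => ⟨j, i, rfl, hi⟩
  simp [inputStore, h]

end CoveringGame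

namespace RAM

open CoveringGame

variable {n m : ℕ} {G : CoveringGame n m}

/-- The entry of the incidence matrix for the set and the agent in registers `x` and `y`. -/
def NExpr.incidence (x y : ℕ) : NExpr := .arr 0 (.add (.arr 2 (.reg x)) (.reg y))

theorem eval_incidence {σ : Store} {s : Strategy n} (h : G.Represents σ s) {x y : ℕ} {j : Fin m}
    {i : Fin n} (hx : σ.reg x = j) (hy : σ.reg y = i) :
    (NExpr.incidence x y).eval σ = if i ∈ G.sets j then 1 else 0 := by
  simp only [NExpr.incidence, NExpr.eval, hx, hy]
  exact h.incidence j i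

/-- Write the positions of the rows of the incidence matrix into array `2`. -/
def Cmd.prepare : Cmd :=
  .forLoop 3 1 (.seq (.setArr 2 (.reg 3) (.reg 2)) (.setReg 2 (.add (.reg 2) (.reg 0))))

theorem haltsWithin_prepare {Q : Store → Prop}
    (hQ : ∀ τ, G.Represents τ (fun _ => false) → Q τ) :
    HaltsWithin .prepare G.inputStore ((m + 1) * (20 + 7)) Q := by
  refine HaltsWithin.mono (HaltsWithin.forLoop (fun k τ => τ.reg 3 = k ∧ τ.reg 0 = n ∧
    τ.reg 1 = m ∧ τ.reg 2 = k * n ∧ τ.arr 0 = G.inputStore.arr 0 ∧ (∀ i, τ.arr 1 i = 0) ∧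
    ∀ j < k, τ.arr 2 j = j * n) ?_ ?_ ?_) ?_
  · simp [inputStore]
  · rintro k - τ ⟨h3, -, h1, -⟩
    exact ⟨h3, h1⟩
  · rintro k - τ ⟨h3, h0, h1, h2, ha0, ha1, ha2⟩
    refine HaltsWithin.seq (T₁ := 10) (T₂ := 10) (HaltsWithin.setArr (by simp [NExpr.time]) ?_)
    refine HaltsWithin.setReg (by simp [NExpr.time]) ?_
    simp [NExpr.eval, h3, h2, h0, h1, ha0, ha1, Function.update_apply, add_mul]
    intro j hj
    split_ifs with hjk
    · rw [hjk]
    · exact ha2 j (by omega)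
  · rintro τ ⟨-, h0, h1, -, ha0, ha1, ha2⟩
    refine hQ τ ⟨h0, h1, fun j i => ?_, fun i => by simp [ha1]⟩
    rw [ha2 j j.2, ha0, inputStore_arr_zero]

/-- Compute `Δ₂` in register `6`. -/
def Cmd.maxCommon : Cmd :=
  .seq (.setReg 6 (.const 0)) (.forLoop 9 0 (.forLoop 10 0
    (.branch (.lt (.reg 9) (.reg 10))
      (.seq (.countLoop 3 1 5 (.lt (.const 1) (.add (.incidence 3 9) (.incidence 3 10))))
        (.branch (.lt (.reg 6) (.reg 5)) (.setReg 6 (.reg 5)) .skip))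
      .skip)))

theorem haltsWithin_maxCommon {σ : Store} {s : Strategy n} (h : G.Represents σ s)
    {Q : Store → Prop} (hQ : ∀ τ, G.Represents τ s → τ.reg 6 = G.Δ₂ → Q τ) :
    HaltsWithin .maxCommon σ
      (2 + (n + 1) * ((n + 1) * (3 + (2 + (m + 1) * (13 + 11) + (3 + 2)) + 7) + 7)) Q := by
  refine HaltsWithin.seq (HaltsWithin.setReg (by simp [NExpr.time]) ?_)
  refine HaltsWithin.mono (HaltsWithin.forLoop (N := n) (fun k τ => τ.reg 9 = k ∧
    G.Represents τ s ∧ τ.reg 6 ≤ G.Δ₂ ∧ ∀ a b : Fin n, (a : ℕ) < k → a < b →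
      (Finset.univ.filter fun j => a ∈ G.sets j ∧ b ∈ G.sets j).card ≤ τ.reg 6) ?_ ?_ ?_) ?_
  · exact ⟨by simp, h.of_arr_eq rfl rfl rfl, by simp [NExpr.eval], by simp⟩
  · rintro k - τ ⟨h9, hτ, -⟩
    exact ⟨h9, hτ.reg_zero⟩
  · rintro k hk τ ⟨h9, hτ, h6, hmax⟩
    refine HaltsWithin.mono (HaltsWithin.forLoop (N := n) (fun l τ => τ.reg 10 = l ∧ τ.reg 9 = k ∧
      G.Represents τ s ∧ τ.reg 6 ≤ G.Δ₂ ∧ ∀ a b : Fin n,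
        ((a : ℕ) < k ∨ (a : ℕ) = k ∧ (b : ℕ) < l) → a < b →
        (Finset.univ.filter fun j => a ∈ G.sets j ∧ b ∈ G.sets j).card ≤ τ.reg 6) ?_ ?_ ?_) ?_
    · exact ⟨by simp, by simpa using h9, hτ.of_arr_eq rfl rfl rfl, by simpa using h6,
        by simpa using hmax⟩
    · rintro l - τ ⟨h10, -, hτ, -⟩
      exact ⟨h10, hτ.reg_zero⟩
    · clear! τ
      rintro l hl τ ⟨h10, h9, hτ, h6, hmax⟩
      refine HaltsWithin.branch (by simp [Test.time, NExpr.time]) (fun hkl => ?_) fun hkl => ?_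
      · refine HaltsWithin.seq (HaltsWithin.countLoop (N := m) (by simp) (by simp) (by simp)
          hτ.reg_one (fun j => ⟨k, hk⟩ ∈ G.sets j ∧ ⟨l, hl⟩ ∈ G.sets j) (fun j v => ?_) ?_)
        · have hρ : G.Represents
              { τ with reg := Function.update (Function.update τ.reg 5 v) 3 j } s :=
            hτ.of_arr_eq rfl rfl rfl
          simp only [Test.Holds, NExpr.eval]
          rw [eval_incidence (i := ⟨k, hk⟩) (j := j) hρ (by simp) (by simpa using h9),
            eval_incidence (i := ⟨l, hl⟩) (j := j) hρ (by simp) (by simpa using h10)]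
          split_ifs <;> simp [*]
        · have hcard := G.card_filter_le_Δ₂ (i := ⟨k, hk⟩) (k := ⟨l, hl⟩) (by
            simp only [Test.Holds, NExpr.eval, h9, h10] at hkl
            simp [Fin.ext_iff, hkl.ne])
          have hsplit : ∀ a b : Fin n, ((a : ℕ) < k ∨ (a : ℕ) = k ∧ (b : ℕ) < l + 1) →
              ((a : ℕ) < k ∨ (a : ℕ) = k ∧ (b : ℕ) < l) ∨ a = ⟨k, hk⟩ ∧ b = ⟨l, hl⟩ := by
            intro a b hab
            simp only [Fin.ext_iff]
            omega
          refine HaltsWithin.branch (by simp [Test.time, NExpr.time]) (fun hlt => ?_) fun hlt => ?_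
          · refine HaltsWithin.setReg (by simp [NExpr.time]) ?_
            simp only [Test.Holds, NExpr.eval] at hlt
            simp at hlt
            refine ⟨by simpa using h10, by simp, by simpa using h9,
              hτ.of_arr_eq rfl rfl rfl, by simpa [NExpr.eval] using hcard, fun a b hab hlt' => ?_⟩
            simp [NExpr.eval]
            rcases hsplit a b hab with hab | ⟨rfl, rfl⟩
            · exact (hmax a b hab hlt').trans hlt.le
            · exact le_rfl
          · refine HaltsWithin.skip (by simp) ?_
            simp only [Test.Holds, NExpr.eval] at hlt
            simp at hlt
            refine ⟨by simpa using h10, by simp, by simpa using h9,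
              hτ.of_arr_eq rfl rfl rfl, by simpa using h6, fun a b hab hlt' => ?_⟩
            simp
            rcases hsplit a b hab with hab | ⟨rfl, rfl⟩
            · exact hmax a b hab hlt'
            · exact hlt
      · refine HaltsWithin.skip (by omega) ?_
        simp only [Test.Holds, NExpr.eval, h9, h10] at hkl
        refine ⟨h10, by simp, by simpa using h9, hτ.of_arr_eq rfl rfl rfl, by simpa using h6,
          fun a b hab hlt' => ?_⟩
        simp
        refine hmax a b ?_ hlt'
        rw [Fin.lt_def] at hlt'
        omega
    · clear! τ
      rintro τ ⟨-, h9, hτ, h6, hmax⟩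
      refine ⟨h9, by simp, hτ.of_arr_eq rfl rfl rfl, by simpa using h6, fun a b hab hlt => ?_⟩
      simp
      refine hmax a b ?_ hlt
      have := b.2
      omega
  · rintro τ ⟨-, hτ, h6, hmax⟩
    refine hQ τ hτ (le_antisymm h6 (Finset.sup_le fun p _ => ?_))
    by_cases hp : p.1 = p.2
    · simp [hp]
    · rcases lt_or_gt_of_ne hp with hlt | hlt
      · simpa [hp] using hmax p.1 p.2 p.1.2 hlt
      · simpa [hp, and_comm] using hmax p.2 p.1 p.2.2 hlt

/-- The expression `k * e`, as an iterated sum. -/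
def NExpr.nsmul (e : NExpr) : ℕ → NExpr
  | 0 => .const 0
  | k + 1 => .add (e.nsmul k) e

theorem NExpr.eval_nsmul (σ : Store) (e : NExpr) (k : ℕ) : (e.nsmul k).eval σ = k * e.eval σ := by
  induction k with
  | zero => simp [nsmul, eval]
  | succ k ih => simp [nsmul, eval, ih, add_mul]

theorem NExpr.time_nsmul (e : NExpr) (k : ℕ) : (e.nsmul k).time = 1 + k * (e.time + 1) := by
  induction k with
  | zero => simp [nsmul, time]
  | succ k ih => simp only [nsmul, time, ih]; ring

/-- Compute the pruning threshold `c₀ * Δ₂ * (⌈log₂ n⌉ + 1)` in register `8`, by doubling register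
`7` until it is at least `n`. -/
def Cmd.threshold (c₀ : ℕ) : Cmd :=
  .seq (.setReg 8 ((NExpr.reg 6).nsmul c₀)) (.seq (.setReg 2 (.reg 8)) (.seq (.setReg 7 (.const 1))
    (.forLoop 3 0 (.branch (.lt (.reg 7) (.reg 0))
      (.seq (.setReg 7 (.add (.reg 7) (.reg 7))) (.setReg 8 (.add (.reg 8) (.reg 2)))) .skip))))

theorem haltsWithin_threshold (c₀ : ℕ) {σ : Store} {s : Strategy n} (h : G.Represents σ s)
    (h6 : σ.reg 6 = G.Δ₂) {Q : Store → Prop}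
    (hQ : ∀ τ, G.Represents τ s → τ.reg 8 = c₀ * G.Δ₂ * (Nat.clog 2 n + 1) → Q τ) :
    HaltsWithin (.threshold c₀) σ ((2 + c₀ * 2) + (2 + (2 + (n + 1) * (3 + (4 + 4) + 7)))) Q := by
  refine HaltsWithin.seq (HaltsWithin.setReg (by rw [NExpr.time_nsmul]; simp [NExpr.time]) ?_)
  refine HaltsWithin.seq (HaltsWithin.setReg (by simp [NExpr.time]) ?_)
  refine HaltsWithin.seq (HaltsWithin.setReg (by simp [NExpr.time]) ?_)
  have hclog : Nat.clog 2 n ≤ n := Nat.clog_le_of_le_pow n.lt_two_pow_self.le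
  refine HaltsWithin.mono (HaltsWithin.forLoop (N := n) (fun k τ => τ.reg 3 = k ∧
    G.Represents τ s ∧ τ.reg 2 = c₀ * G.Δ₂ ∧ τ.reg 7 = 2 ^ min k (Nat.clog 2 n) ∧
    τ.reg 8 = c₀ * G.Δ₂ * (min k (Nat.clog 2 n) + 1)) ?_ ?_ ?_) ?_
  · refine ⟨by simp, h.of_arr_eq rfl rfl rfl, ?_, ?_, ?_⟩ <;>
      simp [NExpr.eval, NExpr.eval_nsmul, h6]
  · rintro k - τ ⟨h3, hτ, -⟩
    exact ⟨h3, hτ.reg_zero⟩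
  · rintro k hk τ ⟨h3, hτ, h2, h7, h8⟩
    refine HaltsWithin.branch (by simp [Test.time, NExpr.time]) (fun hlt => ?_) fun hlt => ?_
    · simp only [Test.Holds, NExpr.eval, h7, hτ.reg_zero] at hlt
      have hk' : k < Nat.clog 2 n := by
        by_contra hk'
        rw [min_eq_right (by omega)] at hlt
        exact absurd (Nat.le_pow_clog (by norm_num : 1 < 2) n) (by omega)
      refine HaltsWithin.seq (T₁ := 4) (T₂ := 4) (HaltsWithin.setReg (by simp [NExpr.time]) ?_)
      refine HaltsWithin.setReg (by simp [NExpr.time]) ?_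
      refine ⟨by simpa using h3, by simp, hτ.of_arr_eq rfl rfl rfl, by simpa using h2, ?_, ?_⟩
      · simp [NExpr.eval, h7, min_eq_left hk'.le, min_eq_left (Nat.succ_le_of_lt hk'), pow_succ,
          mul_two]
      · simp [NExpr.eval, h8, h2, min_eq_left hk'.le, min_eq_left (Nat.succ_le_of_lt hk')]
        ring
    · simp only [Test.Holds, NExpr.eval, h7, hτ.reg_zero] at hlt
      have hk' : Nat.clog 2 n ≤ k := by
        by_contra hk'
        rw [min_eq_left (by omega)] at hlt
        exact hk' (Nat.clog_le_of_le_pow (by omega))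
      refine HaltsWithin.skip (by simp) ⟨h3, by simp, hτ.of_arr_eq rfl rfl rfl, by simpa using h2,
        ?_, ?_⟩
      · simp [h7, min_eq_right hk', min_eq_right (hk'.trans (Nat.le_succ k))]
      · simp [h8, min_eq_right hk', min_eq_right (hk'.trans (Nat.le_succ k))]
  · rintro τ ⟨-, hτ, -, -, h8⟩
    exact hQ τ hτ (by rw [h8, min_eq_right hclog])

end RAM

/-! ### Greedy covering and pruning -/

namespace CoveringGame

variable {n m : ℕ} (G : CoveringGame n m)

/-- The invariant of the covering phase: the on agents are the union of a family of disjoint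
nonempty sets, and they cover the first `k` sets. -/
def CoversFirst (k : ℕ) (s : Strategy n) : Prop :=
  (∃ T : Finset (Fin m), (∀ j ∈ T, (j : ℕ) < k) ∧ (T : Set (Fin m)).PairwiseDisjoint G.sets ∧
    (∀ j ∈ T, (G.sets j).Nonempty) ∧ onAgents s = T.biUnion G.sets) ∧
  ∀ j : Fin m, (j : ℕ) < k → (G.sets j).Nonempty → ¬ G.Uncovered s j

variable {G}

theorem CoversFirst.succ_of_covered {s : Strategy n} {j : Fin m} (h : G.CoversFirst j s)
    (hj : ¬ G.Uncovered s j) : G.CoversFirst (j + 1) s := by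
  obtain ⟨⟨T, h1, h2⟩, h3⟩ := h
  refine ⟨⟨T, fun i hi => (h1 i hi).trans (Nat.lt_succ_self _), h2⟩, fun i hi hne => ?_⟩
  rcases Nat.lt_succ_iff_lt_or_eq.mp hi with hi | hi
  · exact h3 i hi hne
  · rwa [Fin.ext hi]

theorem CoversFirst.succ_of_uncovered {s : Strategy n} {j : Fin m} (h : G.CoversFirst j s)
    (hj : G.Uncovered s j) : G.CoversFirst (j + 1) (fun i => s i || decide (i ∈ G.sets j)) := by
  obtain ⟨⟨T, h1, h2, h3, h4⟩, h5⟩ := h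
  refine ⟨?_, fun i hi hne => ?_⟩
  · by_cases hne : (G.sets j).Nonempty
    · refine ⟨insert j T, fun i hi => ?_, ?_, ?_, ?_⟩
      · rcases Finset.mem_insert.mp hi with rfl | hi
        · exact Nat.lt_succ_self _
        · exact (h1 i hi).trans (Nat.lt_succ_self _)
      · rw [Finset.coe_insert, Set.pairwiseDisjoint_insert]
        refine ⟨h2, fun i hi _ => Finset.disjoint_left.mpr fun k hk hki => ?_⟩
        have : k ∈ onAgents s := h4 ▸ Finset.mem_biUnion.mpr ⟨i, hi, hki⟩
        rw [mem_onAgents, hj k hk] at this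
        exact absurd this (by simp)
      · simpa [hne] using h3
      · rw [Finset.biUnion_insert, ← h4]
        ext i
        simp [or_comm]
    · refine ⟨T, fun i hi => (h1 i hi).trans (Nat.lt_succ_self _), h2, h3, ?_⟩
      rw [← h4]
      ext i
      simp [Finset.not_nonempty_iff_eq_empty.mp hne]
  · intro hu
    rcases Nat.lt_succ_iff_lt_or_eq.mp hi with hi | hi
    · refine h5 i hi hne fun k hk => ?_
      have := hu k hk
      simp only [Bool.or_eq_false_iff] at this
      exact this.1
    · obtain rfl : i = j := Fin.ext hi
      obtain ⟨k, hk⟩ := hne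
      have := hu k hk
      simp [hk] at this

variable (G)

/-- The invariant of the pruning phase, started in `s₀`, after the first `k` agents: each agent that
was turned off paid for fewer than `D` newly uncovered sets. -/
structure PrunedFirst (s₀ : Strategy n) (D k : ℕ) (s : Strategy n) : Prop where
  subset : onAgents s ⊆ onAgents s₀
  card_uncoveredSets_le :
    (G.uncoveredSets s).card + D * (onAgents s).card ≤ D * (onAgents s₀).card
  le_soleCount : ∀ i : Fin n, (i : ℕ) < k → s i = true → D ≤ G.soleCount s i

variable {G}

theorem soleCount_le_update_false (s : Strategy n) {i k : Fin n} (hik : i ≠ k) :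
    G.soleCount s i ≤ G.soleCount (Function.update s k false) i := by
  refine Finset.card_le_card fun j hj => ?_
  simp only [Finset.mem_filter, Finset.mem_univ, true_and] at hj ⊢
  refine ⟨hj.1, by rw [Function.update_of_ne hik]; exact hj.2.1, fun l hl hsl => ?_⟩
  refine hj.2.2 l hl ?_
  by_cases hlk : l = k
  · subst hlk; simp at hsl
  · rwa [Function.update_of_ne hlk] at hsl

theorem PrunedFirst.succ_of_le {s₀ s : Strategy n} {D : ℕ} {k : Fin n} (h : G.PrunedFirst s₀ D k s)
    (hk : D ≤ G.soleCount s k) : G.PrunedFirst s₀ D (k + 1) s := by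
  refine ⟨h.subset, h.card_uncoveredSets_le, fun i hi hsi => ?_⟩
  rcases Nat.lt_succ_iff_lt_or_eq.mp hi with hi | hi
  · exact h.le_soleCount i hi hsi
  · rwa [Fin.ext hi]

theorem PrunedFirst.succ_of_lt {s₀ s : Strategy n} {D : ℕ} {k : Fin n} (h : G.PrunedFirst s₀ D k s)
    (hk : G.soleCount s k < D) : G.PrunedFirst s₀ D (k + 1) (Function.update s k false) := by
  by_cases hs : s k = true
  · have hon : onAgents (Function.update s k false) = (onAgents s).erase k := by
      ext i
      by_cases hik : i = k
      · subst hik; simp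
      · simp [hik]
    refine ⟨hon ▸ (Finset.erase_subset _ _).trans h.subset, ?_, fun i hi hsi => ?_⟩
    · have hsub : G.uncoveredSets (Function.update s k false) ⊆
          G.uncoveredSets s ∪ G.soleSets s k := by
        intro j hj
        rw [mem_uncoveredSets] at hj
        have hu : ∀ l ∈ G.sets j, l ≠ k → s l = false := fun l hl hlk => by
          have := hj.2 l hl
          rwa [Function.update_of_ne hlk] at this
        rw [Finset.mem_union, mem_uncoveredSets]
        by_cases hkj : k ∈ G.sets j
        · right
          simp only [soleSets, Finset.mem_filter, Finset.mem_univ, true_and]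
          refine ⟨hkj, hs, fun l hl hsl => ?_⟩
          by_contra hlk
          rw [hu l hl hlk] at hsl
          exact absurd hsl (by simp)
        · exact Or.inl ⟨hj.1, fun l hl => hu l hl fun h => hkj (h ▸ hl)⟩
      have hcard := (Finset.card_le_card hsub).trans (Finset.card_union_le _ _)
      have hpos : (onAgents s).card = ((onAgents s).erase k).card + 1 :=
        (Finset.card_erase_add_one (by simpa using hs)).symm
      have := h.card_uncoveredSets_le
      rw [hpos, mul_add, mul_one] at this
      rw [hon]
      change _ ≤ _ + G.soleCount s k at hcard
      omega
    · have hik : i ≠ k := by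
        rintro rfl
        simp at hsi
      rw [Function.update_of_ne hik] at hsi
      have hi' : (i : ℕ) < k :=
        lt_of_le_of_ne (Nat.lt_succ_iff.mp hi) fun h => hik (Fin.ext h)
      exact (h.le_soleCount i hi' hsi).trans (soleCount_le_update_false s hik)
  · have hupd : Function.update s k false = s := by
      rw [Function.update_eq_self_iff]
      simpa using Eq.symm (by simpa using hs)
    rw [hupd]
    refine ⟨h.subset, h.card_uncoveredSets_le, fun i hi hsi => h.le_soleCount i ?_ hsi⟩
    refine lt_of_le_of_ne (Nat.lt_succ_iff.mp hi) fun h => hs ?_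
    rwa [← Fin.ext h]

theorem CoversFirst.isPruned {s₀ s : Strategy n} {D K : ℕ} (hK : G.Fmax ≤ K)
    (h₀ : G.CoversFirst m s₀) (h : G.PrunedFirst s₀ D n s) : G.IsPruned K D s := by
  obtain ⟨⟨T, -, h2, h3, h4⟩, -⟩ := h₀
  have hcard : (onAgents s₀).card ≤ K * T.card := by
    rw [h4, mul_comm]
    exact Finset.card_biUnion_le_card_mul _ _ _ fun j _ => (G.card_sets_le_Fmax j).trans hK
  refine ⟨⟨T, h2, h3, (Finset.card_le_card h.subset).trans hcard, ?_⟩,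
    fun i hi => h.le_soleCount i i.2 hi⟩
  calc (G.uncoveredSets s).card ≤ D * (onAgents s₀).card :=
        (Nat.le_add_right _ _).trans h.card_uncoveredSets_le
    _ ≤ _ := Nat.mul_le_mul_left _ hcard

theorem CoversFirst.prunedFirst {s : Strategy n} (h : G.CoversFirst m s) (D : ℕ) :
    G.PrunedFirst s D 0 s := by
  refine ⟨subset_rfl, ?_, by simp⟩
  rw [Finset.card_eq_zero.mpr, zero_add]
  refine Finset.eq_empty_of_forall_notMem fun j hj => ?_
  rw [mem_uncoveredSets] at hj
  exact h.2 j j.2 hj.1 hj.2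

end CoveringGame

namespace RAM

open CoveringGame

variable {n m : ℕ} {G : CoveringGame n m}

/-- Count in register `5` the on agents of the set in register `r`. -/
def Cmd.countOn (r : ℕ) : Cmd :=
  .countLoop 4 0 5 (.lt (.const 1) (.add (.incidence r 4) (.arr 1 (.reg 4))))

theorem haltsWithin_countOn {σ : Store} {s : Strategy n} (h : G.Represents σ s) {r : ℕ}
    (hr4 : r ≠ 4) (hr5 : r ≠ 5) {j : Fin m} (hj : σ.reg r = j) {Q : Store → Prop}
    (hQ : Q { σ with
      reg := Function.update (Function.update σ.reg 5
        (Finset.univ.filter fun i => i ∈ G.sets j ∧ s i = true).card) 4 n }) :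
    HaltsWithin (.countOn r) σ (2 + (n + 1) * 21) Q := by
  refine HaltsWithin.countLoop (by simp) (by simp) (by simp) h.reg_zero
    (fun i => i ∈ G.sets j ∧ s i = true) (fun i v => ?_) hQ
  have hρ : G.Represents { σ with reg := Function.update (Function.update σ.reg 5 v) 4 i } s :=
    h.of_arr_eq rfl rfl rfl
  simp only [Test.Holds, NExpr.eval]
  rw [eval_incidence (i := i) (j := j) hρ (by simp [hr4, hr5, hj]) (by simp), Function.update_self,
    hρ.strategy]
  split_ifs <;> simp [*]

/-- Turn on all elements of each set that is not yet covered. -/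
def Cmd.cover : Cmd :=
  .forLoop 3 1 (.seq (.countOn 3) (.branch (.lt (.reg 5) (.const 1))
    (.forLoop 4 0 (.setArr 1 (.reg 4) (.add (.arr 1 (.reg 4)) (.incidence 3 4)))) .skip))

theorem haltsWithin_cover {D : ℕ} {σ : Store} (h : G.Represents σ fun _ => false)
    (h8 : σ.reg 8 = D) {Q : Store → Prop}
    (hQ : ∀ τ s, G.Represents τ s → τ.reg 8 = D → G.CoversFirst m s → Q τ) :
    HaltsWithin .cover σ ((m + 1) * ((2 + (n + 1) * 21) + (3 + (n + 1) * (10 + 7)) + 7)) Q := by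
  refine HaltsWithin.mono (HaltsWithin.forLoop (N := m) (fun k τ => τ.reg 3 = k ∧ τ.reg 8 = D ∧
    ∃ s, G.Represents τ s ∧ G.CoversFirst k s) ?_ ?_ ?_) ?_
  · refine ⟨by simp, by simpa using h8, _, h.of_arr_eq rfl rfl rfl, ⟨∅, ?_⟩, by simp⟩
    simp [onAgents]
  · rintro k - τ ⟨h3, -, s, hτ, -⟩
    exact ⟨h3, hτ.reg_one⟩
  · rintro k hk τ ⟨h3, h8, s, hτ, hs⟩
    obtain ⟨j, rfl⟩ : ∃ j : Fin m, k = j := ⟨⟨k, hk⟩, rfl⟩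
    refine HaltsWithin.seq (haltsWithin_countOn hτ (by simp) (by simp) h3 ?_)
    have hiff : (Finset.univ.filter fun i => i ∈ G.sets j ∧ s i = true).card < 1 ↔
        G.Uncovered s j := by
      rw [Nat.lt_one_iff, Finset.card_eq_zero, Finset.filter_eq_empty_iff]
      simp [Uncovered]
    refine HaltsWithin.branch (by simp [Test.time, NExpr.time]) (fun hu => ?_) fun hu => ?_
    -- all elements of the set are off, so that adding the row of the matrix sets them to `1`
    · replace hu : G.Uncovered s j := hiff.mp (by simpa [Test.Holds, NExpr.eval] using hu)
      refine HaltsWithin.mono (HaltsWithin.forLoop (N := n) (fun k τ => τ.reg 4 = k ∧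
        τ.reg 3 = j ∧ τ.reg 8 = D ∧ G.Represents τ fun i => s i || decide ((i : ℕ) < k ∧
          i ∈ G.sets j)) ?_ ?_ ?_) ?_
      · refine ⟨by simp, by simpa using h3, by simpa using h8, ?_⟩
        simp only [Nat.not_lt_zero, false_and, decide_false, Bool.or_false]
        exact hτ.of_arr_eq rfl rfl rfl
      · rintro k - τ ⟨h4, -, -, hτ⟩
        exact ⟨h4, hτ.reg_zero⟩
      · clear! τ
        rintro k hk τ ⟨h4, h3, h8, hτ⟩
        refine HaltsWithin.setArr (by simp [NExpr.time, NExpr.incidence]) ?_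
        refine ⟨h4, by simp, by simpa using h3, by simpa using h8, ?_⟩
        refine ⟨by simpa using hτ.reg_zero, by simpa using hτ.reg_one, ?_, fun i => ?_⟩
        · simpa using hτ.incidence
        · have h1 := hτ.strategy i
          simp only [NExpr.eval, Function.update_self, h4]
          by_cases hik : (i : ℕ) = k
          · rw [hik, Function.update_self, ← hik, h1,
              eval_incidence hτ (i := i) h3 (by rw [h4, hik])]
            have := hu i
            by_cases hij : i ∈ G.sets j
            · simp [hij, this hij, hik]
            · simp [hij]
          · rw [Function.update_of_ne hik, h1]
            have : (i : ℕ) < k + 1 ↔ (i : ℕ) < k := by omega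
            simp only [this]
      · clear! τ
        rintro τ ⟨-, h3, h8, hτ⟩
        refine ⟨h3, by simp, by simpa using h8, _, ?_, hs.succ_of_uncovered hu⟩
        simp only [Fin.is_lt, true_and] at hτ
        exact hτ.of_arr_eq rfl rfl rfl
    · replace hu : ¬ G.Uncovered s j := fun hu' => hu (by
        simpa [Test.Holds, NExpr.eval] using hiff.mpr hu')
      refine HaltsWithin.skip (by omega) ⟨by simpa using h3, by simp, by simpa using h8, s,
        hτ.of_arr_eq rfl rfl rfl, hs.succ_of_covered hu⟩
  · rintro τ ⟨-, h8, s, hτ, hs⟩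
    exact hQ τ s hτ h8 hs

/-- Turn off, one after the other, each agent that is the unique on element of fewer sets than the
threshold in register `8`. For the agent `i` in register `9`, array `3` first receives the number
`a` of on elements of each set. With `u` and `v` the indicators of `i` being in the set and of `i`
being on, the test `a + 2 < 2 * u + 2 * v` then says that `u = v = 1` and `a = 1`, since `u = v =
1` forces `a ≥ 1`. -/
def Cmd.prune : Cmd :=
  .forLoop 9 0 (.seq (.forLoop 10 1 (.seq (.countOn 10) (.setArr 3 (.reg 10) (.reg 5))))
    (.seq (.countLoop 3 1 5 (.lt (.add (.arr 3 (.reg 3)) (.const 2))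
      (.add (.add (.incidence 3 9) (.incidence 3 9)) (.add (.arr 1 (.reg 9)) (.arr 1 (.reg 9))))))
      (.branch (.lt (.reg 5) (.reg 8)) (.setArr 1 (.reg 9) (.const 0)) .skip)))

theorem haltsWithin_prune {D : ℕ} {σ : Store} {s₀ : Strategy n} (h : G.Represents σ s₀)
    (h8 : σ.reg 8 = D) (h₀ : G.CoversFirst m s₀) {Q : Store → Prop}
    (hQ : ∀ τ s, G.Represents τ s → G.PrunedFirst s₀ D n s → Q τ) :
    HaltsWithin .prune σ ((n + 1) * (((m + 1) * ((2 + (n + 1) * 21) + 5 + 7)) +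
      ((2 + (m + 1) * (22 + 11)) + (3 + 5)) + 7)) Q := by
  refine HaltsWithin.mono (HaltsWithin.forLoop (N := n) (fun k τ => τ.reg 9 = k ∧ τ.reg 8 = D ∧
    ∃ s, G.Represents τ s ∧ G.PrunedFirst s₀ D k s) ?_ ?_ ?_) ?_
  · exact ⟨by simp, by simpa using h8, _, h.of_arr_eq rfl rfl rfl, h₀.prunedFirst D⟩
  · rintro k - τ ⟨h9, -, s, hτ, -⟩
    exact ⟨h9, hτ.reg_zero⟩
  · rintro k hk τ ⟨h9, h8, s, hτ, hs⟩
    obtain ⟨i, rfl⟩ : ∃ i : Fin n, k = i := ⟨⟨k, hk⟩, rfl⟩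
    refine HaltsWithin.seq (HaltsWithin.mono (HaltsWithin.forLoop (N := m) (fun l τ =>
      τ.reg 10 = l ∧ τ.reg 9 = i ∧ τ.reg 8 = D ∧ G.Represents τ s ∧ ∀ j : Fin m, (j : ℕ) < l →
        τ.arr 3 j = (Finset.univ.filter fun i => i ∈ G.sets j ∧ s i = true).card) ?_ ?_ ?_) ?_)
    · exact ⟨by simp, by simpa using h9, by simpa using h8, hτ.of_arr_eq rfl rfl rfl, by simp⟩
    · rintro l - τ ⟨h10, -, -, hτ, -⟩
      exact ⟨h10, hτ.reg_one⟩
    · clear! τ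
      rintro l hl τ ⟨h10, h9, h8, hτ, ha⟩
      obtain ⟨j, rfl⟩ : ∃ j : Fin m, l = j := ⟨⟨l, hl⟩, rfl⟩
      refine HaltsWithin.seq (haltsWithin_countOn hτ (by simp) (by simp) h10 ?_)
      refine HaltsWithin.setArr (by simp [NExpr.time]) ?_
      refine ⟨by simpa using h10, by simp, by simpa using h9, by simpa using h8, ?_, ?_⟩
      · exact ⟨by simpa using hτ.reg_zero, by simpa using hτ.reg_one, by simpa using hτ.incidence,
          by simpa using hτ.strategy⟩
      · intro j' hj'
        by_cases hjj : j' = j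
        · simp [NExpr.eval, hjj, h10]
        · have : (j' : ℕ) ≠ j := fun h => hjj (Fin.ext h)
          simp [NExpr.eval, h10, this]
          exact ha j' (by omega)
    · clear! τ
      rintro τ ⟨-, h9, h8, hτ, ha⟩
      refine HaltsWithin.seq (HaltsWithin.countLoop (N := m) (by simp) (by simp) (by simp)
        hτ.reg_one (fun j => i ∈ G.sets j ∧ s i = true ∧ ∀ k ∈ G.sets j, s k = true → k = i)
        (fun j v => ?_) ?_)
      · have hρ : G.Represents
            { τ with reg := Function.update (Function.update τ.reg 5 v) 3 j } s :=
          hτ.of_arr_eq rfl rfl rfl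
        simp only [Test.Holds, NExpr.eval]
        rw [eval_incidence (i := i) (j := j) hρ (by simp) (by simpa using h9), Function.update_self,
          ha j j.2, Function.update_of_ne (by simp), Function.update_of_ne (by simp), h9,
          hτ.strategy]
        by_cases hij : i ∈ G.sets j
        · by_cases hsi : s i = true
          · have hle : (Finset.univ.filter fun i => i ∈ G.sets j ∧ s i = true).card ≤ 1 ↔
                ∀ k ∈ G.sets j, s k = true → k = i := by
              have : Nonempty (Fin n) := ⟨i⟩
              rw [Finset.card_le_one_iff_subset_singleton]
              constructor
              · rintro ⟨a, ha⟩ k hk hsk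
                have h1 : k = a := by simpa using ha (by simp [hk, hsk])
                have h2 : i = a := by simpa using ha (by simp [hij, hsi])
                rw [h1, h2]
              · exact fun h => ⟨i, fun k hk => by
                  simp only [Finset.mem_filter, Finset.mem_univ, true_and] at hk
                  simpa using h k hk.1 hk.2⟩
            rw [← hle]
            simp only [hij, hsi, if_true, true_and]
            omega
          · simp [hij, hsi]
        · by_cases hsi : s i = true <;> simp [hij, hsi]
      · refine HaltsWithin.branch (by simp [Test.time, NExpr.time]) (fun hlt => ?_) fun hlt => ?_
        · replace hlt : G.soleCount s i < D := by
            simpa [Test.Holds, NExpr.eval, soleCount, h8] using hlt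
          refine HaltsWithin.setArr (by simp [NExpr.time]) ?_
          refine ⟨by simpa using h9, by simp, by simpa using h8, _, ?_, hs.succ_of_lt hlt⟩
          refine ⟨by simpa using hτ.reg_zero, by simpa using hτ.reg_one,
            by simpa using hτ.incidence, fun k => ?_⟩
          by_cases hki : k = i
          · simp [NExpr.eval, hki, h9]
          · have : (k : ℕ) ≠ i := fun h => hki (Fin.ext h)
            simp [NExpr.eval, hki, h9, this, hτ.strategy]
        · replace hlt : D ≤ G.soleCount s i := by
            simpa [Test.Holds, NExpr.eval, soleCount, h8] using hlt
          exact HaltsWithin.skip (by simp) ⟨by simpa using h9, by simp, by simpa using h8, s,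
            hτ.of_arr_eq rfl rfl rfl, hs.succ_of_le hlt⟩
  · rintro τ ⟨-, -, s, hτ, hs⟩
    exact hQ τ s hτ hs

end RAM

/-! ### The algorithm -/

namespace RAM

open CoveringGame

/-- Cover greedily by disjoint sets and prune with the threshold `c₀ * Δ₂ * (⌈log₂ n⌉ + 1)`. -/
def Cmd.coverAndPrune (c₀ : ℕ) : Cmd :=
  .seq .prepare (.seq .maxCommon (.seq (.threshold c₀) (.seq .cover .prune)))

theorem exists_haltsWithin_coverAndPrune (c₀ K : ℕ) :
    ∃ p : Polynomial ℕ, ∀ (n m : ℕ) (G : CoveringGame n m), G.Fmax ≤ K →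
      HaltsWithin (.coverAndPrune c₀) G.inputStore (p.eval (n + m)) fun σ =>
        G.IsPruned K (c₀ * G.Δ₂ * (Nat.clog 2 n + 1)) (σ.strategy n) := by
  have hbound : ∃ p : Polynomial ℕ, ∀ n m : ℕ,
      ((m + 1) * (20 + 7) +
        ((2 + (n + 1) * ((n + 1) * (3 + (2 + (m + 1) * (13 + 11) + (3 + 2)) + 7) + 7)) +
        (((2 + c₀ * 2) + (2 + (2 + (n + 1) * (3 + (4 + 4) + 7)))) +
        ((m + 1) * ((2 + (n + 1) * 21) + (3 + (n + 1) * (10 + 7)) + 7) +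
        (n + 1) * (((m + 1) * ((2 + (n + 1) * 21) + 5 + 7)) +
          ((2 + (m + 1) * (22 + 11)) + (3 + 5)) + 7))))) ≤ p.eval (n + m) := by
    refine ⟨1000 * (Polynomial.X + 1) ^ 3 + Polynomial.C (c₀ * 2), fun n m => ?_⟩
    simp only [Polynomial.eval_mul, Polynomial.eval_add, Polynomial.eval_pow, Polynomial.eval_X,
      Polynomial.eval_C, Polynomial.eval_ofNat, Polynomial.eval_one]
    ring_nf
    linarith [Nat.zero_le (m * n), Nat.zero_le (m * n ^ 2), Nat.zero_le (m ^ 2 * n),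
      Nat.zero_le (m ^ 2), Nat.zero_le (m ^ 3), Nat.zero_le (n ^ 2), Nat.zero_le (n ^ 3)]
  obtain ⟨p, hp⟩ := hbound
  refine ⟨p, fun n m G hK => ?_⟩
  suffices h : HaltsWithin (.coverAndPrune c₀) G.inputStore _ fun σ =>
      G.IsPruned K (c₀ * G.Δ₂ * (Nat.clog 2 n + 1)) (σ.strategy n) by
    obtain ⟨t, τ, h1, h2, h3⟩ := h
    exact ⟨t, τ, h1, h2.trans (hp n m), h3⟩
  refine HaltsWithin.seq (haltsWithin_prepare (G := G) fun σ₁ h1 => ?_)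
  refine HaltsWithin.seq (haltsWithin_maxCommon h1 fun σ₂ h2 h6 => ?_)
  refine HaltsWithin.seq (haltsWithin_threshold c₀ h2 h6 fun σ₃ h3 h8 => ?_)
  refine HaltsWithin.seq (haltsWithin_cover h3 h8 fun σ₄ s₀ h4 h8 hcov => ?_)
  refine haltsWithin_prune h4 h8 hcov fun τ s hτ hs => ?_
  have : τ.strategy n = s := by
    funext i
    rw [Store.strategy, hτ.strategy i]
    cases s i <;> simp
  rw [this]
  exact hcov.isPruned hK hs

end RAM

theorem mainTheorem4 (α : unitInterval) (hα0 : 0 < α) (hα1 : α < 1) (K : ℕ)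
    (lo hi : ℝ) (hlo : 0 < lo) :
    ∃ (P : RAM.Cmd) (p : Polynomial ℕ) (C : ℝ),
      ∀ (n m : ℕ) (G : CoveringGame n m),
        G.Fmax ≤ K →
        (∀ i, lo ≤ G.cost i ∧ G.cost i ≤ hi) →
        (∀ j, lo ≤ G.weight j ∧ G.weight j ≤ hi) →
        ∃ (t : ℕ) (σ : RAM.Store),
          RAM.Runs P G.inputStore t σ ∧ t ≤ p.eval (n + m) ∧
          (1 ≤ G.Δ₂ →
            G.Star (α : ℝ) (σ.strategy n) ∧
            G.socialCost (σ.strategy n) ≤ C * (G.Δ₂ * Real.log n) * G.opt ∧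
            1 - 1 / (n : ℝ) ≤
              G.probFinalCostLE α (σ.strategy n) (C * (G.Δ₂ * Real.log n) * G.opt)) := by
  obtain ⟨c₀, C, hC⟩ := CoveringGame.exists_pruning_threshold α hα0 hα1 K lo hi hlo
  obtain ⟨p, hp⟩ := RAM.exists_haltsWithin_coverAndPrune c₀ K
  refine ⟨.coverAndPrune c₀, p, C, fun n m G hK hc hw => ?_⟩
  obtain ⟨t, σ, h1, h2, h3⟩ := hp n m G hK
  exact ⟨t, σ, h1, h2, fun hΔ => hC n m G hK hc hw hΔ _ h3⟩
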